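/- **Setting.** There are $K$ arms and one resource. At every round $t=1,2,\dots$ arm $k$ would yield a reward $r_{k,t}\in[0,1]$ and consume an amount $c_{k,t}\in[0,1]$ of the resource; the pair $(r_{k,t},c_{k,t})$ has a fixed law $\nu_k$ and is independent of everything that happened at the earlier rounds (the arms may be arbitrarily correlated within a round). Put $\mu^r_k=\mathbb E[r_{k,t}]$ and $\mu^c_k=\mathbb E[c_{k,t}]$, and assume $\mu^c_k>0$ for all $k$. Put $$\epsilon=\min_k\mu^c_k,\qquad \Delta_k=\max_j\frac{\mu^r_j}{\mu^c_j}-\frac{\mu^r_k}{\mu^c_k},\qquad \Delta=\min\{\Delta_k : \Delta_k>0\}.$$ An algorithm pulls one arm $a_t$ per round. It is non-anticipating if $a_t$ is a measurable function of $(r_{a_s,s},c_{a_s,s})_{1\le s<t}$. For a budget $B\ge 0$ let $\tau^*=\min\{t : \sum_{s=1}^t c_{a_s,s}>B\}$, and define the regret $$R_B=\mathrm{OPT}(B)-\mathbb E\Big[\sum_{t=1}^{\tau^*-1}r_{a_t,t}\Big],$$ where $\mathrm{OPT}(B)$ is the supremum of the expected payoff $\mathbb E[\sum_{t=1}^{\tau^*-1}r_{a_t,t}]$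 over all non-anticipating algorithms (which may use the knowledge of the laws $\nu_k$ and of $B$). Let $\widetilde R_B\ge R_B$ be the same quantity when the rewards that the algorithm collects during its initialization phase (see below) are not credited to it, while its consumption during that phase is still charged. **Algorithm.** Let $\kappa\ge\max_k\mu^r_k/\mu^c_k$ be known and put $\lambda=1+\kappa$. Let $n_{k,t}$ be the number of pulls of arm $k$ before round $t$, let $\bar r_{k,t},\bar c_{k,t}$ be the corresponding empirical means, and let $\epsilon_{k,t}=\sqrt{2\ln t/n_{k,t}}$. UCB-Simplex first pulls each arm until the amount of resource consumed by that arm is non-zero (initialization phase; as long as some arm has not consumed anything, an arm of this kind is pulled, in any order). At every later round it pulls, with arbitrary tie-breaking, an arm $$a_t\in\arg\max_k\frac{\bar r_{k,t}+\lambda\,\epsilon_{k,t}}{\bar c_{k,t}}.$$ **Theorem.** For every run of UCB-Simplex as above and every $B\ge0$, $\mathrm{OPT}(B)$ is finite and $$0\le R_B\le\widetilde R_B\le 2^6\lambda^2\Big(\sum_{k:\Delta_k>0}\frac1{\mu^c_k\Delta_k}\Big)\ln\Big(\frac{B+1}{\epsilon}\Big)+C,$$ where $C$ depends only on $K$, $\kappa$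 and $\epsilon$ (in particular, not on $B$). Moreover, there is a constant $C'$ that depends only on $\kappa$ and $\epsilon$ such that, if some $\Delta_k$ is positive, then for every $B\ge2$ $$R_B\le\widetilde R_B\le C'\,\frac{K\ln B}{\Delta},$$ that is, $R_B=O(K\ln(B)/\Delta)$. -/

import Mathlib

open MeasureTheory ProbabilityTheory

noncomputable section

namespace Knapsack

/-- A stochastic environment with `K` arms and one resource on the probability space `(Ω, P)`.
Rounds are numbered `t = 1, 2, …` (the index `0` is never used).  `outcome t k ω` is the pair
(reward, resource consumption) which arm `k` would yield at round `t`.  It has law `law k`, which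
lives on `[0,1] × [0,1]`, and it is independent of everything that happened at earlier rounds.
Nothing is assumed on the correlation between the arms at a given round. -/
structure Environment (K : ℕ) (Ω : Type*) [MeasurableSpace Ω] (P : Measure Ω) where
  law : Fin K → Measure (ℝ × ℝ)
  outcome : ℕ → Fin K → Ω → ℝ × ℝ
  measurable_outcome : ∀ t k, Measurable (outcome t k)
  map_outcome : ∀ t, 1 ≤ t → ∀ k, P.map (outcome t k) = law k
  law_mem : ∀ k, ∀ᵐ z ∂(law k), z.1 ∈ Set.Icc (0 : ℝ) 1 ∧ z.2 ∈ Set.Icc (0 : ℝ) 1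
  indep_past : ∀ t, 1 ≤ t → ∀ k,
    IndepFun (outcome t k) (fun ω (s : Finset.Ico 1 t) (j : Fin K) => outcome s j ω) P

variable {K : ℕ} {Ω : Type*} [MeasurableSpace Ω] {P : Measure Ω}

namespace Environment

/-- Mean reward `μ^r_k`. -/
def meanReward (E : Environment K Ω P) (k : Fin K) : ℝ := ∫ z, z.1 ∂(E.law k)

/-- Mean consumption `μ^c_k`. -/
def meanCost (E : Environment K Ω P) (k : Fin K) : ℝ := ∫ z, z.2 ∂(E.law k)

/-- `ε = min_k μ^c_k`. -/
def minCost (E : Environment K Ω P) : ℝ := ⨅ k, E.meanCost k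

/-- The optimality gap `Δ_k = max_j μ^r_j / μ^c_j - μ^r_k / μ^c_k`. -/
def gap (E : Environment K Ω P) (k : Fin K) : ℝ :=
  (⨆ j, E.meanReward j / E.meanCost j) - E.meanReward k / E.meanCost k

/-- `Δ = min {Δ_k | Δ_k > 0}` (used only when some `Δ_k` is positive). -/
def minGap (E : Environment K Ω P) : ℝ := sInf {x | ∃ k, E.gap k = x ∧ 0 < x}

/-! A run of an algorithm is a sequence `a t ω` of pulled arms. -/

/-- The outcome observed at round `t`. -/
def observed (E : Environment K Ω P) (a : ℕ → Ω → Fin K) (t : ℕ) (ω : Ω) : ℝ × ℝ :=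
  E.outcome t (a t ω) ω

/-- `a` is non-anticipating: the arm pulled at round `t` is a function of the rewards and
consumptions observed at the rounds `1, …, t - 1`. -/
def NonAnticipating (E : Environment K Ω P) (a : ℕ → Ω → Fin K) : Prop :=
  ∀ t, 1 ≤ t →
    Measurable[⨆ s ∈ Finset.Ico 1 t, MeasurableSpace.comap (E.observed a s) inferInstance] (a t)

/-- The round `τ*` at which the game ends: the first `t` such that the consumption of the rounds
`1, …, t` exceeds `B` (`⊤` if there is none). -/
def endTime (E : Environment K Ω P) (a : ℕ → Ω → Fin K) (B : ℝ) (ω : Ω) : ℕ∞ :=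
  ⨅ (t : ℕ) (_ : B < ∑ s ∈ Finset.Icc 1 t, (E.observed a s ω).2), (t : ℕ∞)

/-- The expected payoff `𝔼[∑_{t = 1}^{τ* - 1} r_{a_t, t}]`. -/
def payoff (E : Environment K Ω P) (a : ℕ → Ω → Fin K) (B : ℝ) : ENNReal :=
  ∫⁻ ω, ∑' t : ℕ, {t : ℕ | 1 ≤ t ∧ (t : ℕ∞) < E.endTime a B ω}.indicator
    (fun t => ENNReal.ofReal (E.observed a t ω).1) t ∂P

/-- The largest expected payoff of a non-anticipating algorithm, which may be tailored to the
environment and to `B`. -/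
def optPayoff (E : Environment K Ω P) (B : ℝ) : ENNReal :=
  ⨆ (a : ℕ → Ω → Fin K) (_ : E.NonAnticipating a), E.payoff a B

/-- The (pseudo) regret `R_B`. -/
def regret (E : Environment K Ω P) (a : ℕ → Ω → Fin K) (B : ℝ) : ℝ :=
  (E.optPayoff B).toReal - (E.payoff a B).toReal

/-! Statistics of arm `k` before round `t`. -/

/-- The rounds before `t` at which arm `k` was pulled. -/
def pulls (a : ℕ → Ω → Fin K) (k : Fin K) (t : ℕ) (ω : Ω) : Finset ℕ :=
  (Finset.Ico 1 t).filter (fun s => a s ω = k)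

/-- Total reward of arm `k` before round `t`. -/
def totalReward (E : Environment K Ω P) (a : ℕ → Ω → Fin K) (k : Fin K) (t : ℕ) (ω : Ω) : ℝ :=
  ∑ s ∈ pulls a k t ω, (E.observed a s ω).1

/-- Total consumption of arm `k` before round `t`. -/
def totalCost (E : Environment K Ω P) (a : ℕ → Ω → Fin K) (k : Fin K) (t : ℕ) (ω : Ω) : ℝ :=
  ∑ s ∈ pulls a k t ω, (E.observed a s ω).2

/-- The number of pulls `n_{k,t}`. -/
def numPulls (a : ℕ → Ω → Fin K) (k : Fin K) (t : ℕ) (ω : Ω) : ℕ := (pulls a k t ω).card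

/-- The confidence radius `ε_{k,t} = √(2 ln t / n_{k,t})`. -/
def radius (a : ℕ → Ω → Fin K) (k : Fin K) (t : ℕ) (ω : Ω) : ℝ :=
  √(2 * Real.log t / numPulls a k t ω)

/-- The index `(r̄_{k,t} + lam ε_{k,t}) / c̄_{k,t}`. -/
def index (E : Environment K Ω P) (lam : ℝ) (a : ℕ → Ω → Fin K) (k : Fin K) (t : ℕ) (ω : Ω) : ℝ :=
  (E.totalReward a k t ω / numPulls a k t ω + lam * radius a k t ω) /
    (E.totalCost a k t ω / numPulls a k t ω)

/-- At round `t` the initialization is over: every arm has consumed something. -/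
def Initialized (E : Environment K Ω P) (a : ℕ → Ω → Fin K) (t : ℕ) (ω : Ω) : Prop :=
  ∀ k, E.totalCost a k t ω ≠ 0

/-- `a` is a run of UCB-Simplex with exploration factor `lam` for one resource (ties are broken
arbitrarily).  Initialization: each arm is pulled until it has consumed something, i.e. as long as
some arm has not consumed anything yet, such an arm is pulled.  Afterwards, an arm of largest index
is pulled. -/
structure IsUCBSimplex (E : Environment K Ω P) (lam : ℝ) (a : ℕ → Ω → Fin K) : Prop where
  nonAnticipating : E.NonAnticipating a
  initialization : ∀ t, 1 ≤ t → ∀ ω, ¬ E.Initialized a t ω → E.totalCost a (a t ω) t ω = 0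
  step : ∀ t, 1 ≤ t → ∀ ω, E.Initialized a t ω →
    ∀ k, E.index lam a k t ω ≤ E.index lam a (a t ω) t ω

/-- The expected payoff when the rewards obtained during the initialization are not credited
(the resource consumed during the initialization is still charged). -/
def payoffAfterInit (E : Environment K Ω P) (a : ℕ → Ω → Fin K) (B : ℝ) : ENNReal :=
  ∫⁻ ω, ∑' t : ℕ, {t : ℕ | 1 ≤ t ∧ (t : ℕ∞) < E.endTime a B ω ∧ E.Initialized a t ω}.indicator
    (fun t => ENNReal.ofReal (E.observed a t ω).1) t ∂P

/-- The regret when the rewards obtained during the initialization are not credited. -/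
def regretAfterInit (E : Environment K Ω P) (a : ℕ → Ω → Fin K) (B : ℝ) : ℝ :=
  (E.optPayoff B).toReal - (E.payoffAfterInit a B).toReal

end Environment

end Knapsack

end

noncomputable section

namespace Knapsack

namespace Environment

/-! Let `ρ` be the largest ratio of mean reward to mean cost. A pull of arm `k` has mean reward `ρ
μ^c_k - Δ_k μ^c_k`. Whether round `n + 1` takes place is decided by the history of the first `n`
rounds, so a Wald-type identity gives, for every non-anticipating algorithm, expected reward +
expected sum of the `Δ_k μ^c_k` of the pulled arms = `ρ` times expected consumption
(`lintegral_reward_add_gap`).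

The consumption up to and including the final round lies between `B` (almost surely, since the mean
costs are bounded below) and `B + 1`. The upper bound yields `OPT(B) ≤ ρ (B + 1)`. For UCB-Simplex
the lower bound yields a payoff of at least `ρ B`, minus the gap sum, minus 1 for the uncredited
final round, minus `ρ K` for the initialization, during which each arm consumes at most 1
(`le_payoffAfterInit_add`).

It remains to bound the expected number of pulls of each suboptimal arm (`lintegral_pulls_le`). An
exponential supermartingale and a union bound over the number of pulls show that an empirical mean
leaves its confidence interval at round `t` with probability at most `1 / t ^ 2`, which is summable.
Otherwise the index comparison forces `n_{k,t} < x ln t` with `x = 8 λ² / (μ^c_k Δ_k)²`. A play of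
length `T` has at most `x ln T + 1` such pulls; as `𝔼 T ≤ (B + 1) / ε`, concavity of the logarithm
gives `x ln ((B + 1) / ε) + 1` in expectation. Weighting by `Δ_k μ^c_k` gives the theorem, with 8 in
place of `2 ^ 6`. -/

/-! ### Elementary counting and the index comparison -/

theorem sum_indicator_ofReal {Ω : Type*} (A : ℕ → Set Ω) (f : ℕ → Ω → ℝ) (s : Finset ℕ) {ω : Ω}
    (hf : ∀ n, 0 ≤ f n ω) :
    ∑ n ∈ s, (A n).indicator (fun ω => ENNReal.ofReal (f n ω)) ω =
      ENNReal.ofReal (∑ n ∈ s, (A n).indicator (f n) ω) := by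
  rw [ENNReal.ofReal_sum_of_nonneg fun n _ => Set.indicator_apply_nonneg fun _ => hf n]
  refine Finset.sum_congr rfl fun n _ => ?_
  by_cases h : ω ∈ A n <;> simp [h]

theorem sum_pulls_succ {Ω M : Type*} [AddCommMonoid M] {K : ℕ} (a : ℕ → Ω → Fin K) (k : Fin K)
    (n : ℕ) (ω : Ω) (f : ℕ → M) :
    ∑ s ∈ pulls a k (n + 2) ω, f s =
      ∑ s ∈ pulls a k (n + 1) ω, f s + if a (n + 1) ω = k then f (n + 1) else 0 := by
  simp only [pulls, Finset.sum_filter]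
  exact Finset.sum_Ico_succ_top (by omega) _

theorem numPulls_succ {Ω : Type*} {K : ℕ} (a : ℕ → Ω → Fin K) (k : Fin K) (n : ℕ) (ω : Ω) :
    numPulls a k (n + 2) ω = numPulls a k (n + 1) ω + if a (n + 1) ω = k then 1 else 0 := by
  have h := sum_pulls_succ a k n ω fun _ => 1
  simpa [numPulls] using h

/-- The bound by `numPulls` carries the induction: at a counted round it is below `x`, so the new
count is below `x + 1`. -/
theorem sum_pulls_indicator_le {Ω : Type*} {K : ℕ} (a : ℕ → Ω → Fin K) (k : Fin K) (ω : Ω)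
    {x : ℝ} (hx : 0 ≤ x) (N : ℕ) :
    ∑ n ∈ Finset.range N, {ω | a (n + 1) ω = k ∧ (numPulls a k (n + 1) ω : ℝ) < x}.indicator
      (fun _ => (1 : ℝ)) ω ≤ min (numPulls a k (N + 1) ω : ℝ) (x + 1) := by
  induction N with
  | zero => simp [numPulls, pulls]; linarith
  | succ N ih =>
    obtain ⟨ih1, ih2⟩ := le_min_iff.1 ih
    rw [Finset.sum_range_succ, numPulls_succ]
    by_cases h : ω ∈ {ω | a (N + 1) ω = k ∧ (numPulls a k (N + 1) ω : ℝ) < x}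
    · rw [Set.indicator_of_mem h, if_pos h.1]
      have := h.2
      push_cast
      exact le_min (by linarith) (by linarith)
    · rw [Set.indicator_of_notMem h]
      push_cast
      refine le_min ?_ (by linarith)
      split_ifs <;> simp <;> linarith

/-- The index comparison of UCB-Simplex: if the empirical means of the pulled arm (`r`, `c`, with
confidence radius `e`) and of the best arm (`r'`, `c'`, `e'`) are within their confidence
intervals, then the gap of the pulled arm is small compared with its confidence radius. -/
theorem gap_mul_lt_of_index_le {κ r c e r' c' e' μr μc μr' μc' : ℝ} (hμr' : 0 ≤ μr') (hμc' : 0 < μc')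
    (hμc : 0 < μc) (hκ : μr' / μc' ≤ κ) (he : 0 ≤ e) (he' : 0 ≤ e') (hc : 0 < c) (hc' : 0 < c')
    (hind : (r' + (1 + κ) * e') / c' ≤ (r + (1 + κ) * e) / c)
    (h1 : r < μr + e) (h2 : μc - e < c) (h3 : μr' - e' < r') (h4 : c' < μc' + e') :
    (μr' / μc' - μr / μc) * μc < 2 * (1 + κ) * e := by
  set ρ := μr' / μc' with hρ
  have hρ0 : 0 ≤ ρ := div_nonneg hμr' hμc'.le
  have hr' : μr' = ρ * μc' := by rw [hρ]; field_simp
  have hr : μr / μc * μc = μr := by field_simp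
  -- Optimism: the bonus `(1 + κ) e'` covers the reward error `e'` together with the cost error,
  -- which enters as `ρ e' ≤ κ e'`.
  have hbest : ρ ≤ (r' + (1 + κ) * e') / c' := by
    rw [le_div_iff₀ hc']
    have := mul_le_mul_of_nonneg_left h4.le hρ0
    have := mul_le_mul_of_nonneg_right hκ he'
    linarith
  have hk : ρ * c ≤ r + (1 + κ) * e := (le_div_iff₀ hc).1 (hbest.trans hind)
  have := mul_le_mul_of_nonneg_left h2.le hρ0
  have := mul_le_mul_of_nonneg_right hκ he
  rw [sub_mul, hr]
  linarith

/-! ### The filtration generated by the outcomes -/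

variable {K : ℕ} {Ω : Type*} [MeasurableSpace Ω] {P : Measure Ω}

/-- The σ-algebra generated by all the outcomes of the rounds `1, …, n`. -/
@[reducible]
def history (E : Environment K Ω P) (n : ℕ) : MeasurableSpace Ω :=
  MeasurableSpace.comap
    (fun ω (s : Finset.Ico 1 (n + 1)) (j : Fin K) => E.outcome s j ω) inferInstance

theorem history_le (E : Environment K Ω P) (n : ℕ) : E.history n ≤ ‹MeasurableSpace Ω› := by
  refine Measurable.comap_le ?_
  exact measurable_pi_lambda _ fun s => measurable_pi_lambda _ fun j => E.measurable_outcome s j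

theorem measurable_outcome_history (E : Environment K Ω P) {n s : ℕ} (h1 : 1 ≤ s) (hs : s ≤ n)
    (j : Fin K) : Measurable[E.history n] (E.outcome s j) := by
  have h : Measurable[E.history n]
      (fun ω (s : Finset.Ico 1 (n + 1)) (j : Fin K) => E.outcome s j ω) :=
    measurable_iff_comap_le.2 le_rfl
  have hmem : s ∈ Finset.Ico 1 (n + 1) := by simp; omega
  have h2 : Measurable fun x : Finset.Ico 1 (n + 1) → Fin K → ℝ × ℝ => x ⟨s, hmem⟩ j :=
    (measurable_pi_apply j).comp (measurable_pi_apply (⟨s, hmem⟩ : Finset.Ico 1 (n + 1)))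
  exact h2.comp h

theorem history_mono (E : Environment K Ω P) {m n : ℕ} (h : m ≤ n) :
    E.history m ≤ E.history n := by
  have h : Measurable[E.history n]
      (fun ω (s : Finset.Ico 1 (m + 1)) (j : Fin K) => E.outcome s j ω) := by
    refine @measurable_pi_lambda _ _ _ (E.history n) _ _ fun s =>
      @measurable_pi_lambda _ _ _ (E.history n) _ _ fun j => ?_
    have := Finset.mem_Ico.1 s.2
    exact E.measurable_outcome_history this.1 (by omega) j
  exact measurable_iff_comap_le.1 h

theorem measurable_observed_of_measurable_arm (E : Environment K Ω P) {a : ℕ → Ω → Fin K} {n : ℕ}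
    (ha : Measurable[E.history n] (a (n + 1))) :
    Measurable[E.history (n + 1)] (E.observed a (n + 1)) := by
  have h1 : Measurable[E.history (n + 1)] (a (n + 1)) := ha.mono (E.history_mono n.le_succ) le_rfl
  have h2 : ∀ k, Measurable[E.history (n + 1)] (E.outcome (n + 1) k) := fun k =>
    E.measurable_outcome_history (by omega) le_rfl k
  intro s hs
  have : E.observed a (n + 1) ⁻¹' s = ⋃ k, (a (n + 1) ⁻¹' {k} ∩ E.outcome (n + 1) k ⁻¹' s) := by
    ext ω; simp [observed]
  rw [this]
  exact @MeasurableSet.iUnion _ _ (E.history (n + 1)) _ _ fun k =>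
    @MeasurableSet.inter _ (E.history (n + 1)) _ _ (h1 (measurableSet_singleton k)) (h2 k hs)

/-- Strong induction: the arm depends on earlier observations, which depend in turn on the arms
pulled earlier. From here on the larger σ-algebra `history`, which contains the unobserved outcomes
too, replaces the observed one; the next outcome of each arm is independent of it. -/
theorem NonAnticipating.measurable_arm {E : Environment K Ω P} {a : ℕ → Ω → Fin K}
    (ha : E.NonAnticipating a) (n : ℕ) : Measurable[E.history n] (a (n + 1)) := by
  induction n using Nat.strong_induction_on with
  | _ n ih =>
    refine (ha (n + 1) (by omega)).mono ?_ le_rfl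
    refine iSup₂_le fun s hs => ?_
    obtain ⟨h1, h2⟩ := Finset.mem_Ico.1 hs
    obtain ⟨m, rfl⟩ : ∃ m, s = m + 1 := ⟨s - 1, by omega⟩
    refine le_trans ?_ (E.history_mono (show m + 1 ≤ n by omega))
    exact (E.measurable_observed_of_measurable_arm (ih m (by omega))).comap_le

theorem NonAnticipating.measurable_arm_of_le {E : Environment K Ω P} {a : ℕ → Ω → Fin K}
    (ha : E.NonAnticipating a) {n s : ℕ} (h1 : 1 ≤ s) (hs : s ≤ n + 1) :
    Measurable[E.history n] (a s) := by
  obtain ⟨m, rfl⟩ : ∃ m, s = m + 1 := ⟨s - 1, by omega⟩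
  exact (ha.measurable_arm m).mono (E.history_mono (by omega)) le_rfl

theorem NonAnticipating.measurable_observed {E : Environment K Ω P} {a : ℕ → Ω → Fin K}
    (ha : E.NonAnticipating a) {n s : ℕ} (h1 : 1 ≤ s) (hs : s ≤ n) :
    Measurable[E.history n] (E.observed a s) := by
  obtain ⟨m, rfl⟩ : ∃ m, s = m + 1 := ⟨s - 1, by omega⟩
  exact (E.measurable_observed_of_measurable_arm (ha.measurable_arm m)).mono
    (E.history_mono hs) le_rfl

/-! ### The law of an outcome given the past -/

theorem isProbabilityMeasure_law [IsProbabilityMeasure P] (E : Environment K Ω P) (k : Fin K) :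
    IsProbabilityMeasure (E.law k) := by
  rw [← E.map_outcome 1 le_rfl k]
  exact Measure.isProbabilityMeasure_map (E.measurable_outcome 1 k).aemeasurable

theorem lintegral_mul_outcome (E : Environment K Ω P) {n : ℕ} {f : Ω → ENNReal}
    (hf : Measurable[E.history n] f) (k : Fin K) {g : ℝ × ℝ → ENNReal} (hg : Measurable g) :
    ∫⁻ ω, f ω * g (E.outcome (n + 1) k ω) ∂P = (∫⁻ ω, f ω ∂P) * ∫⁻ z, g z ∂(E.law k) := by
  have hind : Indep (E.history n) (MeasurableSpace.comap (E.outcome (n + 1) k) inferInstance) P :=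
    (E.indep_past (n + 1) (by omega) k).symm
  have h := lintegral_mul_eq_lintegral_mul_lintegral_of_independent_measurableSpace
    (E.history_le n) (E.measurable_outcome (n + 1) k).comap_le hind hf
    (hg.comp (comap_measurable (E.outcome (n + 1) k)))
  simp only [Function.comp_apply] at h
  rw [h, ← E.map_outcome (n + 1) (by omega) k, lintegral_map hg (E.measurable_outcome _ _)]

/-- Conditionally on the history, the outcome observed at a round follows the law of the arm
pulled. -/
theorem lintegral_mul_observed {E : Environment K Ω P} {a : ℕ → Ω → Fin K}
    (ha : E.NonAnticipating a) {n : ℕ} {f : Ω → ENNReal} (hf : Measurable[E.history n] f)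
    {g : Fin K → ℝ × ℝ → ENNReal} (hg : ∀ k, Measurable (g k)) :
    ∫⁻ ω, f ω * g (a (n + 1) ω) (E.observed a (n + 1) ω) ∂P =
      ∫⁻ ω, f ω * ∫⁻ z, g (a (n + 1) ω) z ∂(E.law (a (n + 1) ω)) ∂P := by
  have hset : ∀ k, MeasurableSet[E.history n] (a (n + 1) ⁻¹' {k}) := fun k =>
    ha.measurable_arm n (measurableSet_singleton k)
  have hfk : ∀ k, Measurable[E.history n] ((a (n + 1) ⁻¹' {k}).indicator f) := fun k =>
    Measurable.indicator hf (hset k)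
  -- Split according to the pulled arm: the event that it is `k` belongs to the history, and on it
  -- the observation is an outcome of the fixed arm `k`, to which independence applies.
  have e1 : ∀ ω, f ω * g (a (n + 1) ω) (E.observed a (n + 1) ω) =
      ∑ k, (a (n + 1) ⁻¹' {k}).indicator f ω * g k (E.outcome (n + 1) k ω) := by
    intro ω
    rw [Finset.sum_eq_single (a (n + 1) ω)]
    · simp [observed]
    · intro b _ hb
      simp [Set.indicator, hb.symm]
    · simp
  have e2 : ∀ ω, f ω * ∫⁻ z, g (a (n + 1) ω) z ∂(E.law (a (n + 1) ω)) =
      ∑ k, (a (n + 1) ⁻¹' {k}).indicator f ω * ∫⁻ z, g k z ∂(E.law k) := by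
    intro ω
    rw [Finset.sum_eq_single (a (n + 1) ω)]
    · simp
    · intro b _ hb
      simp [Set.indicator, hb.symm]
    · simp
  simp_rw [e1, e2]
  rw [lintegral_finsetSum, lintegral_finsetSum]
  · refine Finset.sum_congr rfl fun k _ => ?_
    rw [E.lintegral_mul_outcome (hfk k) k (hg k), lintegral_mul_const]
    exact (hfk k).mono (E.history_le n) le_rfl
  · intro k _
    exact ((hfk k).mono (E.history_le n) le_rfl).mul_const _
  · intro k _
    exact ((hfk k).mono (E.history_le n) le_rfl).mul
      ((hg k).comp (E.measurable_outcome _ _))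

theorem ae_outcome_mem (E : Environment K Ω P) :
    ∀ᵐ ω ∂P, ∀ t, 1 ≤ t → ∀ k, (E.outcome t k ω).1 ∈ Set.Icc (0 : ℝ) 1 ∧
      (E.outcome t k ω).2 ∈ Set.Icc (0 : ℝ) 1 := by
  refine ae_all_iff.2 fun t => ?_
  by_cases ht : 1 ≤ t
  · simp only [ht, true_imp_iff]
    refine ae_all_iff.2 fun k => ?_
    have h := E.law_mem k
    rw [← E.map_outcome t ht k] at h
    exact ae_of_ae_map (E.measurable_outcome t k).aemeasurable h
  · simp [ht]

theorem ae_observed_mem (E : Environment K Ω P) (a : ℕ → Ω → Fin K) :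
    ∀ᵐ ω ∂P, ∀ t, 1 ≤ t → (E.observed a t ω).1 ∈ Set.Icc (0 : ℝ) 1 ∧
      (E.observed a t ω).2 ∈ Set.Icc (0 : ℝ) 1 := by
  filter_upwards [E.ae_outcome_mem] with ω h t ht using h t ht _

theorem integrable_reward [IsProbabilityMeasure P] (E : Environment K Ω P) (k : Fin K) :
    Integrable (fun z : ℝ × ℝ => z.1) (E.law k) := by
  have := E.isProbabilityMeasure_law k
  refine Integrable.of_mem_Icc 0 1 measurable_fst.aemeasurable ?_
  filter_upwards [E.law_mem k] with z hz using hz.1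

theorem integrable_cost [IsProbabilityMeasure P] (E : Environment K Ω P) (k : Fin K) :
    Integrable (fun z : ℝ × ℝ => z.2) (E.law k) := by
  have := E.isProbabilityMeasure_law k
  refine Integrable.of_mem_Icc 0 1 measurable_snd.aemeasurable ?_
  filter_upwards [E.law_mem k] with z hz using hz.2

theorem lintegral_reward [IsProbabilityMeasure P] (E : Environment K Ω P) (k : Fin K) :
    ∫⁻ z, ENNReal.ofReal z.1 ∂(E.law k) = ENNReal.ofReal (E.meanReward k) := by
  rw [meanReward, ofReal_integral_eq_lintegral_ofReal (E.integrable_reward k)]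
  filter_upwards [E.law_mem k] with z hz using hz.1.1

theorem lintegral_cost [IsProbabilityMeasure P] (E : Environment K Ω P) (k : Fin K) :
    ∫⁻ z, ENNReal.ofReal z.2 ∂(E.law k) = ENNReal.ofReal (E.meanCost k) := by
  rw [meanCost, ofReal_integral_eq_lintegral_ofReal (E.integrable_cost k)]
  filter_upwards [E.law_mem k] with z hz using hz.2.1

theorem meanReward_nonneg (E : Environment K Ω P) (k : Fin K) : 0 ≤ E.meanReward k :=
  integral_nonneg_of_ae (by filter_upwards [E.law_mem k] with z hz using hz.1.1)

theorem meanCost_le_one [IsProbabilityMeasure P] (E : Environment K Ω P) (k : Fin K) :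
    E.meanCost k ≤ 1 := by
  have := E.isProbabilityMeasure_law k
  have h : E.meanCost k ≤ ∫ _, (1 : ℝ) ∂(E.law k) :=
    integral_mono_ae (E.integrable_cost k) (integrable_const _)
      (by filter_upwards [E.law_mem k] with z hz using hz.2.2)
  simpa using h

/-! ### Measurability of the statistics -/

theorem NonAnticipating.measurable_sum_pulls {E : Environment K Ω P} {a : ℕ → Ω → Fin K}
    (ha : E.NonAnticipating a) (k : Fin K) (n : ℕ) {φ : ℝ × ℝ → ℝ} (hφ : Measurable φ) :
    Measurable[E.history n] fun ω => ∑ s ∈ pulls a k (n + 1) ω, φ (E.observed a s ω) := by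
  simp only [pulls, Finset.sum_filter]
  refine Finset.measurable_fun_sum _ fun s hs => ?_
  obtain ⟨h1, h2⟩ := Finset.mem_Ico.1 hs
  refine Measurable.ite (ha.measurable_arm_of_le h1 (by omega) (measurableSet_singleton k))
    (hφ.comp (ha.measurable_observed h1 (by omega))) measurable_const

theorem NonAnticipating.measurable_numPulls {E : Environment K Ω P} {a : ℕ → Ω → Fin K}
    (ha : E.NonAnticipating a) (k : Fin K) (n : ℕ) :
    Measurable[E.history n] fun ω => (numPulls a k (n + 1) ω : ℝ) := by
  have h := ha.measurable_sum_pulls k n (φ := fun _ => 1) measurable_const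
  simpa [numPulls] using h

theorem NonAnticipating.measurableSet_initialized {E : Environment K Ω P} {a : ℕ → Ω → Fin K}
    (ha : E.NonAnticipating a) (n : ℕ) :
    MeasurableSet[E.history n] {ω | E.Initialized a (n + 1) ω} := by
  simp only [Initialized, Set.ofPred_forall]
  refine @MeasurableSet.iInter _ _ (E.history n) _ _ fun k => ?_
  have h : Measurable[E.history n] fun ω => E.totalCost a k (n + 1) ω :=
    ha.measurable_sum_pulls k n measurable_snd
  exact @MeasurableSet.compl _ _ (E.history n) (h (measurableSet_singleton 0))

/-- Total consumption of the rounds `1, …, n`. -/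
def spent (E : Environment K Ω P) (a : ℕ → Ω → Fin K) (n : ℕ) (ω : Ω) : ℝ :=
  ∑ s ∈ Finset.Icc 1 n, (E.observed a s ω).2

/-- The event that the game is not over at the end of round `n`. -/
def alive (E : Environment K Ω P) (a : ℕ → Ω → Fin K) (B : ℝ) (n : ℕ) : Set Ω :=
  {ω | ∀ m ≤ n, E.spent a m ω ≤ B}

theorem NonAnticipating.measurableSet_alive {E : Environment K Ω P} {a : ℕ → Ω → Fin K}
    (ha : E.NonAnticipating a) (B : ℝ) (n : ℕ) : MeasurableSet[E.history n] (E.alive a B n) := by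
  simp only [alive, Set.ofPred_forall]
  refine @MeasurableSet.iInter _ _ (E.history n) _ _ fun m =>
    @MeasurableSet.iInter _ _ (E.history n) _ _ fun hm => ?_
  have h : Measurable[E.history n] fun ω => E.spent a m ω := by
    refine Finset.measurable_fun_sum _ fun s hs => ?_
    obtain ⟨h1, h2⟩ := Finset.mem_Icc.1 hs
    exact measurable_snd.comp (ha.measurable_observed h1 (by omega))
  exact h measurableSet_Iic

/-! ### The payoffs as sums over `n = t - 1` -/

theorem lt_endTime_iff (E : Environment K Ω P) (a : ℕ → Ω → Fin K) (B : ℝ) (t : ℕ) (ω : Ω) :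
    (t : ℕ∞) < E.endTime a B ω ↔ ω ∈ E.alive a B t := by
  rw [← ENat.add_one_le_iff (ENat.natCast_ne_top t), endTime, le_iInf₂_iff]
  simp only [alive, spent, Set.mem_ofPred_eq]
  refine forall_congr' fun m => ?_
  rw [show ((t : ℕ∞) + 1 ≤ (m : ℕ∞)) ↔ t < m by norm_cast]
  constructor
  · intro h hm
    by_contra! hc
    exact absurd (h hc) (by omega)
  · intro h hB
    by_contra! hc
    exact absurd (h hc) (by linarith)

theorem payoff_eq (E : Environment K Ω P) (a : ℕ → Ω → Fin K) (B : ℝ) :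
    E.payoff a B = ∫⁻ ω, ∑' n : ℕ, (E.alive a B (n + 1)).indicator
      (fun ω => ENNReal.ofReal (E.observed a (n + 1) ω).1) ω ∂P := by
  unfold payoff
  refine lintegral_congr fun ω => ?_
  rw [tsum_eq_zero_add' ENNReal.summable]
  rw [Set.indicator_of_notMem (by simp), zero_add]
  refine tsum_congr fun n => ?_
  have h : n + 1 ∈ {t : ℕ | 1 ≤ t ∧ (t : ℕ∞) < E.endTime a B ω} ↔
      ω ∈ E.alive a B (n + 1) := by
    rw [Set.mem_ofPred_eq, E.lt_endTime_iff]
    simp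
  by_cases hω : ω ∈ E.alive a B (n + 1)
  · rw [Set.indicator_of_mem (h.2 hω), Set.indicator_of_mem hω]
  · rw [Set.indicator_of_notMem (mt h.1 hω), Set.indicator_of_notMem hω]

theorem payoffAfterInit_eq (E : Environment K Ω P) (a : ℕ → Ω → Fin K) (B : ℝ) :
    E.payoffAfterInit a B =
      ∫⁻ ω, ∑' n : ℕ, (E.alive a B (n + 1) ∩ {ω | E.Initialized a (n + 1) ω}).indicator
        (fun ω => ENNReal.ofReal (E.observed a (n + 1) ω).1) ω ∂P := by
  unfold payoffAfterInit
  refine lintegral_congr fun ω => ?_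
  rw [tsum_eq_zero_add' ENNReal.summable]
  rw [Set.indicator_of_notMem (by simp), zero_add]
  refine tsum_congr fun n => ?_
  have h : n + 1 ∈ {t : ℕ | 1 ≤ t ∧ (t : ℕ∞) < E.endTime a B ω ∧ E.Initialized a t ω} ↔
      ω ∈ E.alive a B (n + 1) ∩ {ω | E.Initialized a (n + 1) ω} := by
    rw [Set.mem_ofPred_eq, E.lt_endTime_iff]
    simp
  by_cases hω : ω ∈ E.alive a B (n + 1) ∩ {ω | E.Initialized a (n + 1) ω}
  · rw [Set.indicator_of_mem (h.2 hω), Set.indicator_of_mem hω]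
  · rw [Set.indicator_of_notMem (mt h.1 hω), Set.indicator_of_notMem hω]

/-! ### Pathwise estimates -/

theorem spent_succ (E : Environment K Ω P) (a : ℕ → Ω → Fin K) (n : ℕ) (ω : Ω) :
    E.spent a (n + 1) ω = E.spent a n ω + (E.observed a (n + 1) ω).2 :=
  Finset.sum_Icc_succ_top (by omega) _

theorem alive_anti (E : Environment K Ω P) (a : ℕ → Ω → Fin K) (B : ℝ) {m n : ℕ} (h : m ≤ n) :
    E.alive a B n ⊆ E.alive a B m := fun _ hω i hi => hω i (hi.trans h)

theorem sum_alive_cost_eq (E : Environment K Ω P) (a : ℕ → Ω → Fin K) (B : ℝ) (ω : Ω) (N : ℕ)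
    (h : ∀ i < N, ω ∈ E.alive a B i) :
    ∑ n ∈ Finset.range N, (E.alive a B n).indicator (fun ω => (E.observed a (n + 1) ω).2) ω =
      E.spent a N ω := by
  induction N with
  | zero => simp [spent]
  | succ N ih =>
    rw [Finset.sum_range_succ, ih fun i hi => h i (by omega), spent_succ,
      Set.indicator_of_mem (h N (by omega))]

/-- The overshoot is a single round: while the game is alive the sum is at most `B` plus one cost,
and afterwards no term is added. -/
theorem sum_alive_cost_le (E : Environment K Ω P) (a : ℕ → Ω → Fin K) {B : ℝ} (hB : 0 ≤ B) {ω : Ω}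
    (hω : ∀ t, 1 ≤ t → (E.observed a t ω).2 ∈ Set.Icc (0 : ℝ) 1) (N : ℕ) :
    ∑ n ∈ Finset.range N, (E.alive a B n).indicator (fun ω => (E.observed a (n + 1) ω).2) ω ≤
      B + 1 := by
  induction N with
  | zero => simp; linarith
  | succ N ih =>
    by_cases h : ω ∈ E.alive a B N
    · rw [E.sum_alive_cost_eq a B ω (N + 1) fun i hi => E.alive_anti a B (by omega) h, spent_succ]
      exact add_le_add (h N le_rfl) (hω (N + 1) (by omega)).2
    · rw [Finset.sum_range_succ, Set.indicator_of_notMem h, add_zero]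
      exact ih

theorem tsum_alive_cost_le (E : Environment K Ω P) (a : ℕ → Ω → Fin K) {B : ℝ} (hB : 0 ≤ B) {ω : Ω}
    (hω : ∀ t, 1 ≤ t → (E.observed a t ω).2 ∈ Set.Icc (0 : ℝ) 1) :
    ∑' n : ℕ, (E.alive a B n).indicator (fun ω => ENNReal.ofReal (E.observed a (n + 1) ω).2) ω ≤
      ENNReal.ofReal (B + 1) := by
  refine ENNReal.tsum_le_of_sum_range_le fun N => ?_
  rw [sum_indicator_ofReal (E.alive a B) (fun n ω => (E.observed a (n + 1) ω).2) _
    fun n => (hω (n + 1) (by omega)).1]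
  exact ENNReal.ofReal_le_ofReal (E.sum_alive_cost_le a hB hω N)

theorem le_tsum_alive_cost (E : Environment K Ω P) (a : ℕ → Ω → Fin K) {B : ℝ} {ω : Ω}
    (hω : ∀ t, 1 ≤ t → (E.observed a t ω).2 ∈ Set.Icc (0 : ℝ) 1) (hn : ∃ n, ω ∉ E.alive a B n) :
    ENNReal.ofReal B ≤ ∑' n : ℕ,
      (E.alive a B n).indicator (fun ω => ENNReal.ofReal (E.observed a (n + 1) ω).2) ω := by
  classical
  have hmin : ∀ i < Nat.find hn, ω ∈ E.alive a B i := fun i hi => not_not.1 (Nat.find_min hn hi)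
  -- At the first index where the game is over, all earlier totals are at most `B`, so the current
  -- one must exceed it.
  have hsp : B < E.spent a (Nat.find hn) ω := by
    by_contra! hc
    refine Nat.find_spec hn fun m hm => ?_
    rcases hm.lt_or_eq with h | h
    · exact hmin m h m le_rfl
    · rw [h]; exact hc
  refine le_trans ?_ (ENNReal.sum_le_tsum (Finset.range (Nat.find hn)))
  rw [sum_indicator_ofReal (E.alive a B) (fun n ω => (E.observed a (n + 1) ω).2) _
    fun n => (hω (n + 1) (by omega)).1]
  refine ENNReal.ofReal_le_ofReal ?_
  rw [E.sum_alive_cost_eq a B ω _ hmin]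
  exact hsp.le

theorem tsum_alive_diff_le_one (E : Environment K Ω P) (a : ℕ → Ω → Fin K) (B : ℝ) (ω : Ω) :
    ∑' n : ℕ, (E.alive a B n \ E.alive a B (n + 1)).indicator (fun _ => (1 : ENNReal)) ω ≤ 1 := by
  by_cases h : ∃ n, ω ∈ E.alive a B n \ E.alive a B (n + 1)
  · obtain ⟨n, hn⟩ := h
    rw [tsum_eq_single n, Set.indicator_of_mem hn]
    intro m hm
    refine Set.indicator_of_notMem (fun hc => ?_) _
    rcases lt_or_gt_of_ne hm with h | h
    · exact hc.2 (E.alive_anti a B h hn.1)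
    · exact hn.2 (E.alive_anti a B h hc.1)
  · push Not at h
    simp [Set.indicator_of_notMem (h _)]

/-- `alive a B n` says that round `n + 1` is played, `alive a B (n + 1)` that its reward is
credited. They differ only at the round that exhausts the budget, whose reward is at most 1. -/
theorem tsum_alive_reward_le (E : Environment K Ω P) (a : ℕ → Ω → Fin K) (B : ℝ) (I : ℕ → Set Ω)
    {ω : Ω} (hω : ∀ t, 1 ≤ t → (E.observed a t ω).1 ∈ Set.Icc (0 : ℝ) 1) :
    ∑' n : ℕ, (E.alive a B n ∩ I n).indicator
        (fun ω => ENNReal.ofReal (E.observed a (n + 1) ω).1) ω ≤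
      ∑' n : ℕ, (E.alive a B (n + 1) ∩ I n).indicator
        (fun ω => ENNReal.ofReal (E.observed a (n + 1) ω).1) ω + 1 := by
  refine le_trans ?_ (add_le_add le_rfl (E.tsum_alive_diff_le_one a B ω))
  rw [← ENNReal.tsum_add]
  refine ENNReal.tsum_le_tsum fun n => ?_
  by_cases h1 : ω ∈ E.alive a B n ∩ I n
  · by_cases h2 : ω ∈ E.alive a B (n + 1)
    · rw [Set.indicator_of_mem h1, Set.indicator_of_mem (show _ ∈ _ ∩ _ from ⟨h2, h1.2⟩)]
      exact le_self_add
    · rw [Set.indicator_of_mem h1, Set.indicator_of_mem (show _ ∈ _ \ _ from ⟨h1.1, h2⟩)]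
      refine le_trans ?_ le_add_self
      rw [← ENNReal.ofReal_one]
      exact ENNReal.ofReal_le_ofReal (hω (n + 1) (by omega)).2
  · rw [Set.indicator_of_notMem h1]
    exact zero_le

/-- During the initialization the pulled arm has consumed nothing so far. The bound by `totalCost`
shows that its earlier terms sum to at most 0, and the new term is at most 1. -/
theorem sum_init_cost_le (E : Environment K Ω P) {a : ℕ → Ω → Fin K} {ω : Ω}
    (hinit : ∀ t, 1 ≤ t → ¬ E.Initialized a t ω → E.totalCost a (a t ω) t ω = 0)
    (hω : ∀ t, 1 ≤ t → (E.observed a t ω).2 ∈ Set.Icc (0 : ℝ) 1) (k : Fin K) (N : ℕ) :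
    ∑ n ∈ Finset.range N, {ω | ¬ E.Initialized a (n + 1) ω ∧ a (n + 1) ω = k}.indicator
        (fun ω => (E.observed a (n + 1) ω).2) ω ≤ min (E.totalCost a k (N + 1) ω) 1 := by
  induction N with
  | zero => simp [totalCost, pulls]
  | succ N ih =>
    obtain ⟨ih1, ih2⟩ := le_min_iff.1 ih
    obtain ⟨h0, h1⟩ := hω (N + 1) (by omega)
    have hs := sum_pulls_succ a k N ω fun s => (E.observed a s ω).2
    rw [Finset.sum_range_succ, totalCost, hs]
    rw [totalCost] at ih1
    by_cases h : ω ∈ {ω | ¬ E.Initialized a (N + 1) ω ∧ a (N + 1) ω = k}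
    · have hz := hinit (N + 1) (by omega) h.1
      rw [h.2, totalCost] at hz
      rw [Set.indicator_of_mem h, if_pos h.2]
      exact le_min (by linarith) (by linarith)
    · rw [Set.indicator_of_notMem h]
      refine le_min ?_ (by linarith)
      split_ifs <;> linarith

theorem tsum_init_cost_le (E : Environment K Ω P) {a : ℕ → Ω → Fin K} {ω : Ω}
    (hinit : ∀ t, 1 ≤ t → ¬ E.Initialized a t ω → E.totalCost a (a t ω) t ω = 0)
    (hω : ∀ t, 1 ≤ t → (E.observed a t ω).2 ∈ Set.Icc (0 : ℝ) 1) :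
    ∑' n : ℕ, {ω | ¬ E.Initialized a (n + 1) ω}.indicator
        (fun ω => ENNReal.ofReal (E.observed a (n + 1) ω).2) ω ≤ K := by
  refine ENNReal.tsum_le_of_sum_range_le fun N => ?_
  rw [sum_indicator_ofReal (fun n => {ω | ¬ E.Initialized a (n + 1) ω}) (fun n ω => (E.observed a (n + 1) ω).2) _
    fun n => (hω (n + 1) (by omega)).1]
  rw [← ENNReal.ofReal_natCast]
  refine ENNReal.ofReal_le_ofReal ?_
  have h1 : ∀ n, {ω | ¬ E.Initialized a (n + 1) ω}.indicator
        (fun ω => (E.observed a (n + 1) ω).2) ω =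
      ∑ k, {ω | ¬ E.Initialized a (n + 1) ω ∧ a (n + 1) ω = k}.indicator
        (fun ω => (E.observed a (n + 1) ω).2) ω := by
    intro n
    rw [Finset.sum_eq_single (a (n + 1) ω)]
    · by_cases h : E.Initialized a (n + 1) ω <;> simp [h]
    · intro b _ hb
      simp [Set.indicator, hb.symm]
    · simp
  simp_rw [h1]
  rw [Finset.sum_comm]
  calc _ ≤ ∑ _k : Fin K, (1 : ℝ) := Finset.sum_le_sum fun k _ =>
        (E.sum_init_cost_le hinit hω k N).trans (min_le_right _ _)
    _ = K := by simp

/-! ### Expectations of stopped sums -/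

/-- Wald-type identity: `A n` is known before round `n + 1`, so the observation may be replaced by
its conditional mean. In `ENNReal` the exchange of sum and integral needs no integrability. -/
theorem NonAnticipating.lintegral_tsum_observed {E : Environment K Ω P} {a : ℕ → Ω → Fin K}
    (ha : E.NonAnticipating a) {A : ℕ → Set Ω} (hA : ∀ n, MeasurableSet[E.history n] (A n))
    {g : Fin K → ℝ × ℝ → ENNReal} (hg : ∀ k, Measurable (g k)) :
    ∫⁻ ω, ∑' n : ℕ, (A n).indicator
        (fun ω => g (a (n + 1) ω) (E.observed a (n + 1) ω)) ω ∂P =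
      ∫⁻ ω, ∑' n : ℕ, (A n).indicator
        (fun ω => ∫⁻ z, g (a (n + 1) ω) z ∂(E.law (a (n + 1) ω))) ω ∂P := by
  have hA' : ∀ n, MeasurableSet (A n) := fun n => E.history_le n _ (hA n)
  have harm : ∀ n, Measurable (a (n + 1)) := fun n =>
    (ha.measurable_arm n).mono (E.history_le n) le_rfl
  have hobs : ∀ n, Measurable (E.observed a (n + 1)) := fun n =>
    (ha.measurable_observed (by omega) le_rfl).mono (E.history_le (n + 1)) le_rfl
  have hpair : Measurable fun p : Fin K × (ℝ × ℝ) => g p.1 p.2 :=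
    measurable_from_prod_countable_right hg
  have hint : Measurable fun k => ∫⁻ z, g k z ∂(E.law k) := measurable_of_countable _
  rw [lintegral_tsum, lintegral_tsum]
  · refine tsum_congr fun n => ?_
    have hf : Measurable[E.history n] ((A n).indicator fun _ => (1 : ENNReal)) :=
      Measurable.indicator measurable_const (hA n)
    have h := lintegral_mul_observed ha hf hg
    have e : ∀ (f : Ω → ENNReal) ω,
        (A n).indicator (fun _ => (1 : ENNReal)) ω * f ω = (A n).indicator f ω := by
      intro f ω
      by_cases h : ω ∈ A n <;> simp [h]
    rw [lintegral_congr (e _), lintegral_congr (e _)] at h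
    exact h
  · exact fun n => ((hint.comp (harm n)).indicator (hA' n)).aemeasurable
  · exact fun n => ((hpair.comp ((harm n).prodMk (hobs n))).indicator (hA' n)).aemeasurable

theorem meanReward_eq (E : Environment K Ω P) (k : Fin K) (hk : 0 < E.meanCost k) :
    E.meanReward k + E.gap k * E.meanCost k =
      (⨆ j, E.meanReward j / E.meanCost j) * E.meanCost k := by
  rw [gap]
  field_simp
  ring

theorem gap_nonneg (E : Environment K Ω P) (k : Fin K) : 0 ≤ E.gap k :=
  sub_nonneg.2 (le_ciSup (f := fun j => E.meanReward j / E.meanCost j) (Finite.bddAbove_range _) k)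

theorem bestRatio_nonneg (E : Environment K Ω P) (hc : ∀ k, 0 < E.meanCost k) :
    0 ≤ ⨆ j, E.meanReward j / E.meanCost j :=
  Real.iSup_nonneg fun j => div_nonneg (E.meanReward_nonneg j) (hc j).le

theorem ofReal_meanReward_add (E : Environment K Ω P) (hc : ∀ k, 0 < E.meanCost k) (k : Fin K) :
    ENNReal.ofReal (E.meanReward k) + ENNReal.ofReal (E.gap k * E.meanCost k) =
      ENNReal.ofReal (⨆ j, E.meanReward j / E.meanCost j) * ENNReal.ofReal (E.meanCost k) := by
  rw [← ENNReal.ofReal_add (E.meanReward_nonneg k) (mul_nonneg (E.gap_nonneg k) (hc k).le),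
    E.meanReward_eq k (hc k), ENNReal.ofReal_mul (E.bestRatio_nonneg hc)]

section Stopped

variable [IsProbabilityMeasure P] {E : Environment K Ω P} {a : ℕ → Ω → Fin K}

theorem NonAnticipating.lintegral_tsum_reward (ha : E.NonAnticipating a) {A : ℕ → Set Ω}
    (hA : ∀ n, MeasurableSet[E.history n] (A n)) :
    ∫⁻ ω, ∑' n : ℕ, (A n).indicator
        (fun ω => ENNReal.ofReal (E.observed a (n + 1) ω).1) ω ∂P =
      ∫⁻ ω, ∑' n : ℕ, (A n).indicator
        (fun ω => ENNReal.ofReal (E.meanReward (a (n + 1) ω))) ω ∂P := by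
  have h := ha.lintegral_tsum_observed hA (g := fun _ z => ENNReal.ofReal z.1)
    fun _ => measurable_fst.ennreal_ofReal
  simpa only [E.lintegral_reward] using h

theorem NonAnticipating.lintegral_tsum_cost (ha : E.NonAnticipating a) {A : ℕ → Set Ω}
    (hA : ∀ n, MeasurableSet[E.history n] (A n)) :
    ∫⁻ ω, ∑' n : ℕ, (A n).indicator
        (fun ω => ENNReal.ofReal (E.observed a (n + 1) ω).2) ω ∂P =
      ∫⁻ ω, ∑' n : ℕ, (A n).indicator
        (fun ω => ENNReal.ofReal (E.meanCost (a (n + 1) ω))) ω ∂P := by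
  have h := ha.lintegral_tsum_observed hA (g := fun _ z => ENNReal.ofReal z.2)
    fun _ => measurable_snd.ennreal_ofReal
  simpa only [E.lintegral_cost] using h

theorem lintegral_alive_cost_le (E : Environment K Ω P) (a : ℕ → Ω → Fin K) {B : ℝ} (hB : 0 ≤ B) :
    ∫⁻ ω, ∑' n : ℕ, (E.alive a B n).indicator
        (fun ω => ENNReal.ofReal (E.observed a (n + 1) ω).2) ω ∂P ≤ ENNReal.ofReal (B + 1) := by
  calc _ ≤ ∫⁻ _, ENNReal.ofReal (B + 1) ∂P := by
        refine lintegral_mono_ae ?_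
        filter_upwards [E.ae_observed_mem a] with ω hω
        exact E.tsum_alive_cost_le a hB fun t ht => (hω t ht).2
    _ = ENNReal.ofReal (B + 1) := by simp

/-- Source of both regret bounds: dropping the gap term bounds every payoff from above, keeping it
bounds the payoff of UCB-Simplex from below. The gap stands on the reward side to avoid subtraction
in `ENNReal`. -/
theorem NonAnticipating.lintegral_reward_add_gap (ha : E.NonAnticipating a)
    (hc : ∀ k, 0 < E.meanCost k) {A : ℕ → Set Ω} (hA : ∀ n, MeasurableSet[E.history n] (A n)) :
    ∫⁻ ω, ∑' n : ℕ, (A n).indicator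
        (fun ω => ENNReal.ofReal (E.observed a (n + 1) ω).1) ω ∂P +
      ∫⁻ ω, ∑' n : ℕ, (A n).indicator
        (fun ω => ENNReal.ofReal (E.gap (a (n + 1) ω) * E.meanCost (a (n + 1) ω))) ω ∂P =
      ENNReal.ofReal (⨆ j, E.meanReward j / E.meanCost j) *
        ∫⁻ ω, ∑' n : ℕ, (A n).indicator
          (fun ω => ENNReal.ofReal (E.observed a (n + 1) ω).2) ω ∂P := by
  have hmeas : ∀ f : Fin K → ENNReal,
      Measurable fun ω => ∑' n : ℕ, (A n).indicator (fun ω => f (a (n + 1) ω)) ω := fun f =>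
    Measurable.tsum fun n => ((measurable_of_countable f).comp
      ((ha.measurable_arm n).mono (E.history_le n) le_rfl)).indicator (E.history_le n _ (hA n))
  rw [ha.lintegral_tsum_reward hA, ha.lintegral_tsum_cost hA,
    ← lintegral_add_left (hmeas fun k => ENNReal.ofReal (E.meanReward k)),
    ← lintegral_const_mul _ (hmeas fun k => ENNReal.ofReal (E.meanCost k))]
  refine lintegral_congr fun ω => ?_
  rw [← ENNReal.tsum_add, ← ENNReal.tsum_mul_left]
  refine tsum_congr fun n => ?_
  by_cases h : ω ∈ A n
  · simp only [Set.indicator_of_mem h, E.ofReal_meanReward_add hc]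
  · simp [h]

theorem NonAnticipating.payoff_le (ha : E.NonAnticipating a) (hc : ∀ k, 0 < E.meanCost k) {B : ℝ}
    (hB : 0 ≤ B) :
    E.payoff a B ≤ ENNReal.ofReal ((⨆ j, E.meanReward j / E.meanCost j) * (B + 1)) := by
  rw [payoff_eq]
  calc _ ≤ ∫⁻ ω, ∑' n : ℕ, (E.alive a B n).indicator
        (fun ω => ENNReal.ofReal (E.observed a (n + 1) ω).1) ω ∂P :=
        lintegral_mono fun ω => ENNReal.tsum_le_tsum fun n =>
          Set.indicator_le_indicator_of_subset (E.alive_anti a B n.le_succ) (fun _ => zero_le) ω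
    _ ≤ _ := le_self_add
    _ = _ := ha.lintegral_reward_add_gap hc (ha.measurableSet_alive B)
    _ ≤ ENNReal.ofReal (⨆ j, E.meanReward j / E.meanCost j) * ENNReal.ofReal (B + 1) := by
        gcongr; exact E.lintegral_alive_cost_le a hB
    _ = _ := (ENNReal.ofReal_mul (E.bestRatio_nonneg hc)).symm

theorem optPayoff_le (E : Environment K Ω P) (hc : ∀ k, 0 < E.meanCost k) {B : ℝ} (hB : 0 ≤ B) :
    E.optPayoff B ≤ ENNReal.ofReal ((⨆ j, E.meanReward j / E.meanCost j) * (B + 1)) :=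
  iSup₂_le fun _ ha => ha.payoff_le hc hB

/-- The expected duration of the game is at most `(B + 1) / ε`. -/
theorem NonAnticipating.lintegral_duration_le (ha : E.NonAnticipating a) {B ε : ℝ} (hB : 0 ≤ B)
    (hε : 0 < ε) (hc : ∀ k, ε ≤ E.meanCost k) :
    ∫⁻ ω, ∑' n : ℕ, (E.alive a B n).indicator (fun _ => (1 : ENNReal)) ω ∂P ≤
      ENNReal.ofReal ((B + 1) / ε) := by
  have h : ENNReal.ofReal ε *
      ∫⁻ ω, ∑' n : ℕ, (E.alive a B n).indicator (fun _ => (1 : ENNReal)) ω ∂P ≤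
        ENNReal.ofReal (B + 1) := by
    refine le_trans ?_ (E.lintegral_alive_cost_le a hB)
    rw [ha.lintegral_tsum_cost (ha.measurableSet_alive B), ← lintegral_const_mul _
      (Measurable.tsum fun n => measurable_const.indicator
        (E.history_le n _ (ha.measurableSet_alive B n)))]
    refine lintegral_mono fun ω => ?_
    simp only
    rw [← ENNReal.tsum_mul_left]
    refine ENNReal.tsum_le_tsum fun n => ?_
    by_cases h : ω ∈ E.alive a B n
    · simp only [Set.indicator_of_mem h, mul_one]
      exact ENNReal.ofReal_le_ofReal (hc _)
    · simp [h]
  rw [ENNReal.ofReal_div_of_pos hε, ENNReal.le_div_iff_mul_le (by simp [hε]) (by simp), mul_comm]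
  exact h

/-- An endless play has infinite duration, whereas the expected duration is finite. -/
theorem NonAnticipating.ae_exists_not_alive (ha : E.NonAnticipating a) {B ε : ℝ} (hB : 0 ≤ B)
    (hε : 0 < ε) (hc : ∀ k, ε ≤ E.meanCost k) : ∀ᵐ ω ∂P, ∃ n, ω ∉ E.alive a B n := by
  have h := ae_lt_top (Measurable.tsum fun n => measurable_const.indicator
        (E.history_le n _ (ha.measurableSet_alive B n)))
    ((ha.lintegral_duration_le hB hε hc).trans_lt ENNReal.ofReal_lt_top).ne
  filter_upwards [h] with ω hω
  by_contra! hc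
  simp only [Set.indicator_of_mem (hc _)] at hω
  rw [ENNReal.tsum_const_eq_top_of_ne_zero one_ne_zero] at hω
  exact lt_irrefl _ hω

/-- The payoff collected after the initialization, in terms of the gaps of the arms pulled. -/
theorem IsUCBSimplex.le_payoffAfterInit_add {lam : ℝ} (ha : E.IsUCBSimplex lam a) {B ε : ℝ}
    (hB : 0 ≤ B) (hε : 0 < ε) (hc : ∀ k, ε ≤ E.meanCost k) :
    ENNReal.ofReal (⨆ j, E.meanReward j / E.meanCost j) * ENNReal.ofReal B ≤
      E.payoffAfterInit a B + 1 +
        ∫⁻ ω, ∑' n : ℕ, (E.alive a B n ∩ {ω | E.Initialized a (n + 1) ω}).indicator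
          (fun ω => ENNReal.ofReal (E.gap (a (n + 1) ω) * E.meanCost (a (n + 1) ω))) ω ∂P +
        ENNReal.ofReal (⨆ j, E.meanReward j / E.meanCost j) * K := by
  have hna := ha.nonAnticipating
  have hc0 : ∀ k, 0 < E.meanCost k := fun k => hε.trans_le (hc k)
  have hG : ∀ n, MeasurableSet[E.history n]
      (E.alive a B n ∩ {ω | E.Initialized a (n + 1) ω}) := fun n =>
    @MeasurableSet.inter _ (E.history n) _ _ (hna.measurableSet_alive B n)
      (hna.measurableSet_initialized n)
  have h1 : ∫⁻ ω, ∑' n : ℕ, (E.alive a B n ∩ {ω | E.Initialized a (n + 1) ω}).indicator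
        (fun ω => ENNReal.ofReal (E.observed a (n + 1) ω).1) ω ∂P ≤
      E.payoffAfterInit a B + 1 := by
    rw [payoffAfterInit_eq]
    calc _ ≤ ∫⁻ ω, (∑' n : ℕ, (E.alive a B (n + 1) ∩ {ω | E.Initialized a (n + 1) ω}).indicator
          (fun ω => ENNReal.ofReal (E.observed a (n + 1) ω).1) ω + 1) ∂P := by
          refine lintegral_mono_ae ?_
          filter_upwards [E.ae_observed_mem a] with ω hω
          exact E.tsum_alive_reward_le a B (fun n => {ω | E.Initialized a (n + 1) ω})
            fun t ht => (hω t ht).1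
      _ = _ := by rw [lintegral_add_right _ measurable_const]; simp
  -- Almost surely the whole budget is consumed, and at most `K` of it during the initialization.
  have h2 : ENNReal.ofReal B ≤
      ∫⁻ ω, ∑' n : ℕ, (E.alive a B n ∩ {ω | E.Initialized a (n + 1) ω}).indicator
        (fun ω => ENNReal.ofReal (E.observed a (n + 1) ω).2) ω ∂P + K := by
    calc ENNReal.ofReal B = ∫⁻ _, ENNReal.ofReal B ∂P := by simp
      _ ≤ ∫⁻ ω, (∑' n : ℕ, (E.alive a B n ∩ {ω | E.Initialized a (n + 1) ω}).indicator
        (fun ω => ENNReal.ofReal (E.observed a (n + 1) ω).2) ω + K) ∂P := by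
          refine lintegral_mono_ae ?_
          filter_upwards [E.ae_observed_mem a, hna.ae_exists_not_alive hB hε hc] with ω hω hn
          have hω2 : ∀ t, 1 ≤ t → (E.observed a t ω).2 ∈ Set.Icc (0 : ℝ) 1 :=
            fun t ht => (hω t ht).2
          refine (E.le_tsum_alive_cost a hω2 hn).trans ?_
          refine le_trans ?_ (add_le_add le_rfl
            (E.tsum_init_cost_le (fun t ht h => ha.initialization t ht ω h) hω2))
          rw [← ENNReal.tsum_add]
          refine ENNReal.tsum_le_tsum fun n => ?_
          by_cases h1 : ω ∈ E.alive a B n <;> by_cases h2 : E.Initialized a (n + 1) ω <;>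
            simp [h1, h2]
      _ = _ := by rw [lintegral_add_right _ measurable_const]; simp
  calc _ ≤ ENNReal.ofReal (⨆ j, E.meanReward j / E.meanCost j) *
      (∫⁻ ω, ∑' n : ℕ, (E.alive a B n ∩ {ω | E.Initialized a (n + 1) ω}).indicator
        (fun ω => ENNReal.ofReal (E.observed a (n + 1) ω).2) ω ∂P + K) := by gcongr
    _ ≤ _ := by
        rw [mul_add, ← hna.lintegral_reward_add_gap hc0 hG]
        gcongr

end Stopped

/-! ### Concentration of the empirical means -/

/-- Hoeffding's lemma: a variable in an interval of length 1 is sub-Gaussian with variance proxy `1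
/ 4`. -/
theorem lintegral_exp_le_one [IsProbabilityMeasure P] (E : Environment K Ω P) (k : Fin K)
    {φ : ℝ × ℝ → ℝ} (hφ : Measurable φ) {u : ℝ}
    (hu : ∀ᵐ z ∂(E.law k), φ z ∈ Set.Icc u (u + 1)) (θ : ℝ) :
    ∫⁻ z, ENNReal.ofReal (Real.exp (θ * (φ z - ∫ y, φ y ∂(E.law k)) - θ ^ 2 / 8)) ∂(E.law k) ≤
      1 := by
  have := E.isProbabilityMeasure_law k
  have h := hasSubgaussianMGF_of_mem_Icc hφ.aemeasurable hu
  have hi := h.integrable_exp_mul θ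
  have hm := h.mgf_le θ
  simp_rw [Real.exp_sub]
  rw [← ofReal_integral_eq_lintegral_ofReal (hi.div_const _)
    (ae_of_all _ fun z => by positivity), ← ENNReal.ofReal_one]
  refine ENNReal.ofReal_le_ofReal ?_
  rw [integral_div, div_le_one (Real.exp_pos _)]
  refine hm.trans_eq ?_
  congr 1
  simp
  ring

/-- Supermartingale property: a pull of `k` multiplies the exponential by a factor of conditional
mean at most 1, any other pull by 1. This handles the adaptive choice of the rounds at which `k` is
pulled. -/
theorem NonAnticipating.lintegral_exp_sum_pulls_le_one [IsProbabilityMeasure P]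
    {E : Environment K Ω P} {a : ℕ → Ω → Fin K} (ha : E.NonAnticipating a) (k : Fin K)
    {φ : ℝ × ℝ → ℝ} (hφ : Measurable φ) {u : ℝ}
    (hu : ∀ᵐ z ∂(E.law k), φ z ∈ Set.Icc u (u + 1)) (θ : ℝ) (n : ℕ) :
    ∫⁻ ω, ENNReal.ofReal (Real.exp (∑ s ∈ pulls a k (n + 1) ω,
      (θ * (φ (E.observed a s ω) - ∫ y, φ y ∂(E.law k)) - θ ^ 2 / 8))) ∂P ≤ 1 := by
  have := fun j => E.isProbabilityMeasure_law j
  set m := ∫ y, φ y ∂(E.law k)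
  have hψ : Measurable fun z => θ * (φ z - m) - θ ^ 2 / 8 := by fun_prop
  induction n with
  | zero => simp [pulls]
  | succ n ih =>
    set f : Ω → ENNReal := fun ω => ENNReal.ofReal (Real.exp (∑ s ∈ pulls a k (n + 1) ω,
      (θ * (φ (E.observed a s ω) - m) - θ ^ 2 / 8))) with hf
    set g : Fin K → ℝ × ℝ → ENNReal := fun j z =>
      if j = k then ENNReal.ofReal (Real.exp (θ * (φ z - m) - θ ^ 2 / 8)) else 1 with hg
    have hfm : Measurable[E.history n] f :=
      ENNReal.measurable_ofReal.comp
        (Real.measurable_exp.comp (ha.measurable_sum_pulls k n hψ))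
    have hgm : ∀ j, Measurable (g j) := by
      intro j
      by_cases h : j = k
      · simp only [hg, h, if_true]; fun_prop
      · simp only [hg, h, if_false]; exact measurable_const
    have hgi : ∀ j, ∫⁻ z, g j z ∂(E.law j) ≤ 1 := by
      intro j
      by_cases h : j = k
      · subst h
        simpa [hg] using E.lintegral_exp_le_one j hφ hu θ
      · simp [hg, h]
    calc _ = ∫⁻ ω, f ω * g (a (n + 1) ω) (E.observed a (n + 1) ω) ∂P := by
          refine lintegral_congr fun ω => ?_
          rw [sum_pulls_succ, Real.exp_add, ENNReal.ofReal_mul (Real.exp_pos _).le]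
          by_cases h : a (n + 1) ω = k <;> simp [hf, hg, h]
      _ = ∫⁻ ω, f ω * ∫⁻ z, g (a (n + 1) ω) z ∂(E.law (a (n + 1) ω)) ∂P :=
          lintegral_mul_observed ha hfm hgm
      _ ≤ ∫⁻ ω, f ω ∂P := lintegral_mono fun ω => mul_le_of_le_one_right zero_le (hgi _)
      _ ≤ 1 := ih

/-- The event that, before round `t`, the empirical mean of `φ` over the pulls of arm `k` exceeds
its expectation by at least the confidence radius. -/
def deviates (E : Environment K Ω P) (a : ℕ → Ω → Fin K) (φ : ℝ × ℝ → ℝ) (k : Fin K) (t : ℕ) :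
    Set Ω :=
  {ω | 0 < (numPulls a k t ω : ℝ) ∧ numPulls a k t ω * radius a k t ω ≤
    ∑ s ∈ pulls a k t ω, (φ (E.observed a s ω) - ∫ y, φ y ∂(E.law k))}

theorem NonAnticipating.measurableSet_deviates {E : Environment K Ω P} {a : ℕ → Ω → Fin K}
    (ha : E.NonAnticipating a) {φ : ℝ × ℝ → ℝ} (hφ : Measurable φ) (k : Fin K) (n : ℕ) :
    MeasurableSet (E.deviates a φ k (n + 1)) := by
  have h1 : Measurable fun ω => (numPulls a k (n + 1) ω : ℝ) :=
    (ha.measurable_numPulls k n).mono (E.history_le n) le_rfl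
  have h2 : Measurable fun ω => ∑ s ∈ pulls a k (n + 1) ω,
      (φ (E.observed a s ω) - ∫ y, φ y ∂(E.law k)) :=
    (ha.measurable_sum_pulls k n (hφ.sub_const _)).mono (E.history_le n) le_rfl
  have h3 : Measurable fun ω => radius a k (n + 1) ω := by
    unfold radius
    fun_prop
  exact (measurableSet_lt measurable_const h1).inter (measurableSet_le (h1.mul h3) h2)

theorem numPulls_le {Ω : Type*} {K : ℕ} (a : ℕ → Ω → Fin K) (k : Fin K) (n : ℕ) (ω : Ω) :
    numPulls a k (n + 1) ω ≤ n := by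
  refine (Finset.card_filter_le _ _).trans ?_
  simp

/-- The best exponent depends on the random number of pulls; hence a union bound over its values
`j`, with Markov's inequality for each. -/
theorem NonAnticipating.measure_deviates_le [IsProbabilityMeasure P] {E : Environment K Ω P}
    {a : ℕ → Ω → Fin K} (ha : E.NonAnticipating a) (k : Fin K) {φ : ℝ × ℝ → ℝ} (hφ : Measurable φ)
    {u : ℝ} (hu : ∀ᵐ z ∂(E.law k), φ z ∈ Set.Icc u (u + 1)) (n : ℕ) :
    P (E.deviates a φ k (n + 1)) ≤ ENNReal.ofReal (1 / ((n : ℝ) + 1) ^ 2) := by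
  set m := ∫ y, φ y ∂(E.law k) with hm
  have ht : (0 : ℝ) < (n : ℝ) + 1 := by positivity
  have hlog : 0 ≤ Real.log ((n : ℝ) + 1) := Real.log_nonneg (by linarith [n.cast_nonneg (α := ℝ)])
  set W : ℝ → Ω → ENNReal := fun θ ω => ENNReal.ofReal (Real.exp (∑ s ∈ pulls a k (n + 1) ω,
      (θ * (φ (E.observed a s ω) - m) - θ ^ 2 / 8))) with hW
  -- With radius `r`, `θ = 4 r` maximizes `θ r - θ ^ 2 / 8`. The exponent is then at least `j * θ ^
  -- 2 / 8 = 4 log (n + 1)`, whence the threshold `(n + 1) ^ 4`.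
  set θ : ℕ → ℝ := fun j => 4 * √(2 * Real.log ((n : ℝ) + 1) / j)
  have hWm : ∀ x, Measurable (W x) := fun x =>
    (ENNReal.measurable_ofReal.comp (Real.measurable_exp.comp
      (ha.measurable_sum_pulls k n (φ := fun z => x * (φ z - m) - x ^ 2 / 8)
        (by fun_prop)))).mono (E.history_le n) le_rfl
  have hsub : E.deviates a φ k (n + 1) ⊆
      ⋃ j ∈ Finset.Icc 1 n, {ω | ENNReal.ofReal (((n : ℝ) + 1) ^ 4) ≤ W (θ j) ω} := by
    intro ω hω
    obtain ⟨hpos, hdev⟩ := hω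
    set j := numPulls a k (n + 1) ω with hj
    have hj1 : 1 ≤ j := by exact_mod_cast hpos
    refine Set.mem_biUnion (Finset.mem_coe.2 (Finset.mem_Icc.2 ⟨hj1, numPulls_le a k n ω⟩)) ?_
    refine ENNReal.ofReal_le_ofReal ?_
    rw [← Real.exp_log ht, ← Real.exp_nat_mul]
    refine Real.exp_le_exp.2 ?_
    rw [Finset.sum_sub_distrib, ← Finset.mul_sum, Finset.sum_const, nsmul_eq_mul,
      show (pulls a k (n + 1) ω).card = j from rfl]
    have hr : radius a k (n + 1) ω = θ j / 4 := by
      simp only [radius, θ, ← hj]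
      push_cast
      ring
    rw [hr] at hdev
    have hθ : 0 ≤ θ j := by positivity
    have hsq : j * (θ j) ^ 2 = 32 * Real.log ((n : ℝ) + 1) := by
      simp only [θ]
      rw [mul_pow, Real.sq_sqrt (by positivity)]
      field_simp
      ring
    have := mul_le_mul_of_nonneg_left hdev hθ
    push_cast
    nlinarith
  calc P (E.deviates a φ k (n + 1))
      ≤ ∑ j ∈ Finset.Icc 1 n, P {ω | ENNReal.ofReal (((n : ℝ) + 1) ^ 4) ≤ W (θ j) ω} :=
        (measure_mono hsub).trans (measure_biUnion_finset_le _ _)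
    _ ≤ ∑ _j ∈ Finset.Icc 1 n, ENNReal.ofReal (1 / ((n : ℝ) + 1) ^ 4) := by
        refine Finset.sum_le_sum fun j _ => ?_
        refine (meas_ge_le_lintegral_div (hWm _).aemeasurable (by simp; positivity) (by simp)).trans ?_
        rw [ENNReal.ofReal_div_of_pos (by positivity), ENNReal.ofReal_one]
        exact ENNReal.div_le_div_right (ha.lintegral_exp_sum_pulls_le_one k hφ hu _ n) _
    _ = ENNReal.ofReal (n * (1 / ((n : ℝ) + 1) ^ 4)) := by
        rw [Finset.sum_const, Nat.card_Icc, nsmul_eq_mul, ENNReal.ofReal_mul (by positivity),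
          ENNReal.ofReal_natCast, Nat.add_sub_cancel]
    _ ≤ _ := by
        refine ENNReal.ofReal_le_ofReal ?_
        rw [mul_one_div, div_le_div_iff₀ (by positivity) (by positivity)]
        have h1 : (n : ℝ) * (n + 1) ^ 2 ≤ (n + 1) * (n + 1) ^ 2 := by gcongr; linarith
        have h2 : ((n : ℝ) + 1) ^ 3 ≤ ((n : ℝ) + 1) ^ 4 :=
          pow_le_pow_right₀ (by linarith [n.cast_nonneg (α := ℝ)]) (by norm_num)
        nlinarith

/-! ### The number of pulls of a suboptimal arm -/

theorem totalCost_pos {E : Environment K Ω P} {a : ℕ → Ω → Fin K} {t : ℕ} {ω : Ω}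
    (hω : ∀ t, 1 ≤ t → (E.observed a t ω).2 ∈ Set.Icc (0 : ℝ) 1) (h : E.Initialized a t ω)
    (k : Fin K) : 0 < E.totalCost a k t ω := by
  refine lt_of_le_of_ne (Finset.sum_nonneg fun s hs => ?_) (h k).symm
  exact (hω s (Finset.mem_Ico.1 (Finset.mem_filter.1 hs).1).1).1

theorem numPulls_pos {E : Environment K Ω P} {a : ℕ → Ω → Fin K} {t : ℕ} {ω : Ω}
    (h : E.Initialized a t ω) (k : Fin K) : 0 < (numPulls a k t ω : ℝ) := by
  rw [Nat.cast_pos, numPulls, Finset.card_pos]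
  by_contra hc
  exact h k (by simp [totalCost, Finset.not_nonempty_iff_eq_empty.1 hc])

theorem lt_of_notMem_deviates {E : Environment K Ω P} {a : ℕ → Ω → Fin K} {φ : ℝ × ℝ → ℝ}
    {k : Fin K} {t : ℕ} {ω : Ω} (hn : 0 < (numPulls a k t ω : ℝ)) (h : ω ∉ E.deviates a φ k t) :
    (∑ s ∈ pulls a k t ω, φ (E.observed a s ω)) / numPulls a k t ω <
      (∫ y, φ y ∂(E.law k)) + radius a k t ω := by
  have h1 : ¬ numPulls a k t ω * radius a k t ω ≤
    ∑ s ∈ pulls a k t ω, (φ (E.observed a s ω) - ∫ y, φ y ∂(E.law k)) := fun hc => h ⟨hn, hc⟩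
  rw [Finset.sum_sub_distrib, Finset.sum_const, nsmul_eq_mul,
    show (pulls a k t ω).card = numPulls a k t ω from rfl] at h1
  rw [div_lt_iff₀ hn]
  linarith

/-- Unless some empirical mean deviates from its expectation, UCB-Simplex pulls a suboptimal arm
only if it has been pulled a logarithmic number of times. -/
theorem IsUCBSimplex.numPulls_lt {E : Environment K Ω P} {κ : ℝ} {a : ℕ → Ω → Fin K}
    (ha : E.IsUCBSimplex (1 + κ) a) (hc : ∀ k, 0 < E.meanCost k)
    (hκ : ∀ k, E.meanReward k / E.meanCost k ≤ κ) {j k : Fin K}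
    (hj : E.meanReward j / E.meanCost j = ⨆ i, E.meanReward i / E.meanCost i)
    (hk : 0 < E.gap k) {n : ℕ} {ω : Ω}
    (hω : ∀ t, 1 ≤ t → (E.observed a t ω).2 ∈ Set.Icc (0 : ℝ) 1)
    (hI : E.Initialized a (n + 1) ω) (hak : a (n + 1) ω = k)
    (h1 : ω ∉ E.deviates a (fun z => z.1) k (n + 1))
    (h2 : ω ∉ E.deviates a (fun z => -z.2) k (n + 1))
    (h3 : ω ∉ E.deviates a (fun z => -z.1) j (n + 1))
    (h4 : ω ∉ E.deviates a (fun z => z.2) j (n + 1)) :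
    (numPulls a k (n + 1) ω : ℝ) <
      8 * (1 + κ) ^ 2 / (E.meanCost k * E.gap k) ^ 2 * Real.log ((n : ℝ) + 1) := by
  have hnk := numPulls_pos hI k
  have hnj := numPulls_pos hI j
  have h1 := lt_of_notMem_deviates hnk h1
  have h2 := lt_of_notMem_deviates hnk h2
  have h3 := lt_of_notMem_deviates hnj h3
  have h4 := lt_of_notMem_deviates hnj h4
  -- The deviations of the negated coordinates supply the lower confidence bounds.
  rw [Finset.sum_neg_distrib, integral_neg, neg_div] at h2 h3
  have hstep := ha.step (n + 1) (by omega) ω hI j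
  rw [hak] at hstep
  have hkey := gap_mul_lt_of_index_le (E.meanReward_nonneg j) (hc j) (hc k) (hκ j)
    (Real.sqrt_nonneg _) (Real.sqrt_nonneg _) (div_pos (totalCost_pos hω hI k) hnk)
    (div_pos (totalCost_pos hω hI j) hnj) hstep h1
    (by simp only [totalCost, meanCost]; unfold radius at *; linarith)
    (by simp only [totalReward, meanReward]; unfold radius at *; linarith) h4
  change (_ - E.meanReward k / E.meanCost k) * E.meanCost k < _ at hkey
  rw [hj] at hkey
  change E.gap k * E.meanCost k < _ at hkey
  have hx : 0 < E.gap k * E.meanCost k := mul_pos hk (hc k)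
  -- Squaring `gap * cost < 2 (1 + κ) √(2 log t / n)` and solving for `n` gives the constant `8 = 4
  -- * 2`.
  have hsq := pow_lt_pow_left₀ hkey hx.le two_ne_zero
  have hlog : 0 ≤ Real.log ((n : ℝ) + 1) := Real.log_nonneg (by linarith [n.cast_nonneg (α := ℝ)])
  rw [mul_pow (2 * (1 + κ)), Real.sq_sqrt (by push_cast; positivity), ← mul_div_assoc, lt_div_iff₀ hnk] at hsq
  rw [div_mul_eq_mul_div, lt_div_iff₀ (by rw [mul_comm]; positivity)]
  push_cast at hsq
  linarith

theorem tsum_alive_indicator {E : Environment K Ω P} {a : ℕ → Ω → Fin K} {B : ℝ} {ω : Ω} {T : ℕ}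
    (hT : ∀ n, ω ∈ E.alive a B n ↔ n < T) (A : ℕ → Set Ω) :
    ∑' n : ℕ, (E.alive a B n ∩ A n).indicator (fun _ => (1 : ENNReal)) ω =
      ∑ n ∈ Finset.range T, (A n).indicator (fun _ => (1 : ENNReal)) ω := by
  rw [tsum_eq_sum (s := Finset.range T)]
  · refine Finset.sum_congr rfl fun n hn => ?_
    have h := (hT n).2 (Finset.mem_range.1 hn)
    by_cases h2 : ω ∈ A n <;> simp [h, h2]
  · intro n hn
    rw [Finset.mem_range, ← hT] at hn
    simp [hn]

/-- On a play of duration `T`, the rounds at which arm `k` is pulled although it has been pulled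
less than `x log t` times: their number is at most `x log T + 1`, and `log T + 1 ≤ log m + T / m`. -/
theorem tsum_few_pulls_le (E : Environment K Ω P) (a : ℕ → Ω → Fin K) {B : ℝ} (hB : 0 ≤ B) (k : Fin K)
    {x m : ℝ} (hx : 0 ≤ x) (hm : 1 ≤ m) {ω : Ω} (hn : ∃ n, ω ∉ E.alive a B n) :
    ∑' n : ℕ, (E.alive a B n ∩ {ω | a (n + 1) ω = k ∧
        (numPulls a k (n + 1) ω : ℝ) < x * Real.log ((n : ℝ) + 1)}).indicator
          (fun _ => (1 : ENNReal)) ω + ENNReal.ofReal x ≤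
      ENNReal.ofReal (x * Real.log m + 1) + ENNReal.ofReal (x / m) *
        ∑' n : ℕ, (E.alive a B n).indicator (fun _ => (1 : ENNReal)) ω := by
  classical
  obtain ⟨T, hT⟩ : ∃ T, ∀ n, ω ∈ E.alive a B n ↔ n < T := by
    refine ⟨Nat.find hn, fun n => ⟨fun h => ?_, fun h => not_not.1 (Nat.find_min hn h)⟩⟩
    by_contra! hc
    exact Nat.find_spec hn (E.alive_anti a B hc h)
  have hT1 : 1 ≤ T := by
    refine (hT 0).1 fun i hi => ?_
    obtain rfl : i = 0 := by omega
    simpa [spent] using hB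
  have hT' : (1 : ℝ) ≤ T := by exact_mod_cast hT1
  have hdur : ∑' n : ℕ, (E.alive a B n).indicator (fun _ => (1 : ENNReal)) ω = ENNReal.ofReal T := by
    have h := tsum_alive_indicator hT fun _ => Set.univ
    simpa using h
  rw [hdur, tsum_alive_indicator hT]
  have hcount : ∑ n ∈ Finset.range T, {ω | a (n + 1) ω = k ∧
      (numPulls a k (n + 1) ω : ℝ) < x * Real.log ((n : ℝ) + 1)}.indicator
          (fun _ => (1 : ENNReal)) ω ≤ ENNReal.ofReal (x * Real.log T + 1) := by
    have hle := sum_pulls_indicator_le a k ω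
      (mul_nonneg hx (Real.log_nonneg hT') : 0 ≤ x * Real.log T) T
    have h1 := sum_indicator_ofReal (fun n => {ω | a (n + 1) ω = k ∧
      (numPulls a k (n + 1) ω : ℝ) < x * Real.log T}) (fun _ _ => (1 : ℝ)) (Finset.range T)
      (ω := ω) fun _ => zero_le_one
    simp only [ENNReal.ofReal_one] at h1
    refine le_trans ?_ (h1.trans_le (ENNReal.ofReal_le_ofReal (hle.trans (min_le_right _ _))))
    refine Finset.sum_le_sum fun n hn => ?_
    refine Set.indicator_le_indicator_of_subset ?_ (fun _ => zero_le) ω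
    rintro ω' ⟨h1, h2⟩
    refine ⟨h1, h2.trans_le (mul_le_mul_of_nonneg_left ?_ hx)⟩
    refine Real.log_le_log (by positivity) ?_
    exact_mod_cast Finset.mem_range.1 hn
  refine (add_le_add hcount le_rfl).trans ?_
  have hlogT := Real.log_nonneg hT'
  have hlogm := Real.log_nonneg hm
  rw [← ENNReal.ofReal_add (by positivity) hx, ← ENNReal.ofReal_mul (by positivity),
    ← ENNReal.ofReal_add (by positivity) (by positivity)]
  refine ENNReal.ofReal_le_ofReal ?_
  -- The tangent line of the logarithm at `m` stands in for Jensen's inequality: it is linear in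
  -- `T`, so it can be integrated using only `𝔼 T ≤ m`.
  have h := Real.log_le_sub_one_of_pos (show 0 < (T : ℝ) / m by positivity)
  rw [Real.log_div (by positivity) (by positivity)] at h
  have h2 := mul_le_mul_of_nonneg_left h hx
  have h3 : x / m * T = x * (T / m) := by ring
  rw [h3]
  linarith

/-! ### Constants and bounds on the gaps -/

theorem summable_one_div_succ_sq : Summable fun n : ℕ => 1 / ((n : ℝ) + 1) ^ 2 := by
  have h := (summable_nat_add_iff 1).2 (Real.summable_one_div_nat_pow.2 one_lt_two)
  simpa using h

theorem NonAnticipating.measurable_tsum_deviates {E : Environment K Ω P} {a : ℕ → Ω → Fin K}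
    (ha : E.NonAnticipating a) (k : Fin K)
    {φ : ℝ × ℝ → ℝ} (hφ : Measurable φ) :
    Measurable fun ω =>
      ∑' n : ℕ, (E.deviates a φ k (n + 1)).indicator (fun _ => (1 : ENNReal)) ω :=
  Measurable.tsum fun n => measurable_const.indicator (ha.measurableSet_deviates hφ k n)

/-- The constant of the additive term of the regret bound, for one arm. -/
def regretConst (κ : ℝ) : ℝ :=
  2 * κ + 1 + κ * (1 + 4 * ∑' n : ℕ, 1 / ((n : ℝ) + 1) ^ 2)

theorem gap_le (E : Environment K Ω P) {κ : ℝ} (hc : ∀ k, 0 < E.meanCost k)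
    (hκ : ∀ k, E.meanReward k / E.meanCost k ≤ κ) (k : Fin K) : E.gap k ≤ κ := by
  have : Nonempty (Fin K) := ⟨k⟩
  have h1 : (⨆ j, E.meanReward j / E.meanCost j) ≤ κ := ciSup_le hκ
  have h2 : 0 ≤ E.meanReward k / E.meanCost k := div_nonneg (E.meanReward_nonneg k) (hc k).le
  rw [gap]
  linarith

theorem payoffAfterInit_le_payoff (E : Environment K Ω P) (a : ℕ → Ω → Fin K) (B : ℝ) :
    E.payoffAfterInit a B ≤ E.payoff a B := by
  rw [payoffAfterInit_eq, payoff_eq]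
  exact lintegral_mono fun ω => ENNReal.tsum_le_tsum fun n =>
    Set.indicator_le_indicator_of_subset Set.inter_subset_left (fun _ => zero_le) ω

theorem minCost_pos [Nonempty (Fin K)] (E : Environment K Ω P) (hc : ∀ k, 0 < E.meanCost k) :
    0 < E.minCost := by
  obtain ⟨j, hj⟩ := exists_eq_ciInf_of_finite (f := E.meanCost)
  rw [minCost, ← hj]
  exact hc j

theorem minCost_le (E : Environment K Ω P) (k : Fin K) : E.minCost ≤ E.meanCost k :=
  ciInf_le (Finite.bddBelow_range _) k

theorem minGap_le (E : Environment K Ω P) {k : Fin K} (hk : 0 < E.gap k) :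
    E.minGap ≤ E.gap k :=
  csInf_le ⟨0, fun _ ⟨_, _, h⟩ => h.le⟩ ⟨k, rfl, hk⟩

theorem minGap_pos (E : Environment K Ω P) (h : ∃ k, 0 < E.gap k) : 0 < E.minGap := by
  obtain ⟨k, hk⟩ := h
  have hfin : {x | ∃ k, E.gap k = x ∧ 0 < x}.Finite :=
    (Set.finite_range E.gap).subset fun x ⟨k, hk, _⟩ => ⟨k, hk⟩
  have hne : {x | ∃ k, E.gap k = x ∧ 0 < x}.Nonempty := ⟨E.gap k, k, rfl, hk⟩
  obtain ⟨_, _, h⟩ := hne.csInf_mem hfin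
  exact h

theorem sum_one_div_le (E : Environment K Ω P) {ε : ℝ} (hε : 0 < ε) (hc : ∀ k, ε ≤ E.meanCost k)
    (h : ∃ k, 0 < E.gap k) :
    ∑ k with 0 < E.gap k, 1 / (E.meanCost k * E.gap k) ≤ K * (1 / (ε * E.minGap)) := by
  have hpos := E.minGap_pos h
  have hle : ∀ k ∈ Finset.univ.filter (fun k => 0 < E.gap k),
      1 / (E.meanCost k * E.gap k) ≤ 1 / (ε * E.minGap) := fun k hk =>
    one_div_le_one_div_of_le (by positivity) (mul_le_mul (hc k)
      (E.minGap_le (Finset.mem_filter.1 hk).2) hpos.le (hε.le.trans (hc k)))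
  refine (Finset.sum_le_card_nsmul _ _ _ hle).trans ?_
  rw [nsmul_eq_mul]
  gcongr
  exact (Finset.card_filter_le _ _).trans (by simp)

/-! ### From expected pull counts to the regret bound -/

section Stopped

variable [IsProbabilityMeasure P] {E : Environment K Ω P} {a : ℕ → Ω → Fin K}

theorem NonAnticipating.lintegral_tsum_deviates_le (ha : E.NonAnticipating a) (k : Fin K)
    {φ : ℝ × ℝ → ℝ} (hφ : Measurable φ)
    {u : ℝ} (hu : ∀ᵐ z ∂(E.law k), φ z ∈ Set.Icc u (u + 1)) :
    ∫⁻ ω, ∑' n : ℕ, (E.deviates a φ k (n + 1)).indicator (fun _ => (1 : ENNReal)) ω ∂P ≤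
      ENNReal.ofReal (∑' n : ℕ, 1 / ((n : ℝ) + 1) ^ 2) := by
  have hmeas := ha.measurableSet_deviates hφ k
  rw [lintegral_tsum fun n => (measurable_const.indicator (hmeas n)).aemeasurable,
    ENNReal.ofReal_tsum_of_nonneg (fun n => by positivity) summable_one_div_succ_sq]
  refine ENNReal.tsum_le_tsum fun n => ?_
  rw [lintegral_indicator_const (hmeas n), one_mul]
  exact ha.measure_deviates_le k hφ hu n

/-- Integrate the pathwise bound with `m = (B + 1) / ε`, a bound on the expected duration: the
linear term contributes at most `x / m * m = x`, which cancels the `x` added on the left. -/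
theorem NonAnticipating.lintegral_few_pulls_le (ha : E.NonAnticipating a) {B ε : ℝ} (hB : 0 ≤ B)
    (hε : 0 < ε) (hε1 : ε ≤ 1) (hc : ∀ k, ε ≤ E.meanCost k) (k : Fin K) {x : ℝ} (hx : 0 ≤ x) :
    ∫⁻ ω, ∑' n : ℕ, (E.alive a B n ∩ {ω | a (n + 1) ω = k ∧
        (numPulls a k (n + 1) ω : ℝ) < x * Real.log ((n : ℝ) + 1)}).indicator
          (fun _ => (1 : ENNReal)) ω ∂P ≤
      ENNReal.ofReal (x * Real.log ((B + 1) / ε) + 1) := by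
  have hm : 1 ≤ (B + 1) / ε := by rw [one_le_div hε]; linarith
  set m := (B + 1) / ε with hmdef
  have hm0 : 0 < m := by linarith
  have hdur := ha.lintegral_duration_le hB hε hc
  rw [← hmdef] at hdur
  rw [← ENNReal.add_le_add_iff_right (ENNReal.ofReal_ne_top (r := x))]
  calc _ = ∫⁻ ω, (∑' n : ℕ, (E.alive a B n ∩ {ω | a (n + 1) ω = k ∧
        (numPulls a k (n + 1) ω : ℝ) < x * Real.log ((n : ℝ) + 1)}).indicator
          (fun _ => (1 : ENNReal)) ω + ENNReal.ofReal x) ∂P := by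
        rw [lintegral_add_right _ measurable_const]; simp
    _ ≤ ∫⁻ ω, (ENNReal.ofReal (x * Real.log m + 1) + ENNReal.ofReal (x / m) *
        ∑' n : ℕ, (E.alive a B n).indicator (fun _ => (1 : ENNReal)) ω) ∂P := by
        refine lintegral_mono_ae ?_
        filter_upwards [ha.ae_exists_not_alive hB hε hc] with ω hn
        exact E.tsum_few_pulls_le a hB k hx hm hn
    _ = ENNReal.ofReal (x * Real.log m + 1) + ENNReal.ofReal (x / m) *
        ∫⁻ ω, ∑' n : ℕ, (E.alive a B n).indicator (fun _ => (1 : ENNReal)) ω ∂P := by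
        rw [lintegral_add_left measurable_const, lintegral_const_mul' _ _ ENNReal.ofReal_ne_top]
        simp
    _ ≤ ENNReal.ofReal (x * Real.log m + 1) + ENNReal.ofReal (x / m) * ENNReal.ofReal m := by
        gcongr
    _ = _ := by
        rw [← ENNReal.ofReal_mul (by positivity), div_mul_cancel₀ _ hm0.ne']

/-- The expected number of pulls of a suboptimal arm after the initialization. -/
theorem IsUCBSimplex.lintegral_pulls_le {κ : ℝ} (ha : E.IsUCBSimplex (1 + κ) a) {B ε : ℝ}
    (hB : 0 ≤ B) (hε : 0 < ε) (hε1 : ε ≤ 1) (hc : ∀ k, ε ≤ E.meanCost k)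
    (hκ : ∀ k, E.meanReward k / E.meanCost k ≤ κ) {k : Fin K} (hk : 0 < E.gap k) :
    ∫⁻ ω, ∑' n : ℕ, (E.alive a B n ∩ {ω | E.Initialized a (n + 1) ω} ∩
        {ω | a (n + 1) ω = k}).indicator (fun _ => (1 : ENNReal)) ω ∂P ≤
      ENNReal.ofReal (8 * (1 + κ) ^ 2 / (E.meanCost k * E.gap k) ^ 2 * Real.log ((B + 1) / ε) + 1 +
        4 * ∑' n : ℕ, 1 / ((n : ℝ) + 1) ^ 2) := by
  have hna := ha.nonAnticipating
  have hc0 : ∀ k, 0 < E.meanCost k := fun k => hε.trans_le (hc k)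
  have : Nonempty (Fin K) := ⟨k⟩
  obtain ⟨j, hj⟩ := exists_eq_ciSup_of_finite (f := fun i => E.meanReward i / E.meanCost i)
  set x := 8 * (1 + κ) ^ 2 / (E.meanCost k * E.gap k) ^ 2 with hxdef
  have hx : 0 ≤ x := by positivity
  set Z := ∑' n : ℕ, 1 / ((n : ℝ) + 1) ^ 2 with hZ
  have hZ0 : 0 ≤ Z := tsum_nonneg fun n => by positivity
  have hlog : 0 ≤ Real.log ((B + 1) / ε) :=
    Real.log_nonneg (by rw [one_le_div hε]; linarith)
  have mn1 : Measurable fun z : ℝ × ℝ => -z.1 := measurable_fst.neg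
  have mn2 : Measurable fun z : ℝ × ℝ => -z.2 := measurable_snd.neg
  have d1 := hna.lintegral_tsum_deviates_le k measurable_fst (u := 0)
    (by filter_upwards [E.law_mem k] with z hz using by simpa using hz.1)
  have d2 := hna.lintegral_tsum_deviates_le k mn2 (u := -1)
    (by filter_upwards [E.law_mem k] with z hz using ⟨by linarith [hz.2.2], by linarith [hz.2.1]⟩)
  have d3 := hna.lintegral_tsum_deviates_le j mn1 (u := -1)
    (by filter_upwards [E.law_mem j] with z hz using ⟨by linarith [hz.1.2], by linarith [hz.1.1]⟩)
  have d4 := hna.lintegral_tsum_deviates_le j measurable_snd (u := 0)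
    (by filter_upwards [E.law_mem j] with z hz using by simpa using hz.2)
  have hfew := hna.lintegral_few_pulls_le hB hε hε1 hc k hx
  rw [← hZ] at d1 d2 d3 d4
  -- Each pull of `k` is charged to one of four deviations (reward too high or cost too low for `k`,
  -- reward too low or cost too high for the best arm `j`), or else to the few-pulls event.
  calc _ ≤ ∫⁻ ω, (∑' n : ℕ, (E.alive a B n ∩ {ω | a (n + 1) ω = k ∧
          (numPulls a k (n + 1) ω : ℝ) < x * Real.log ((n : ℝ) + 1)}).indicator
            (fun _ => (1 : ENNReal)) ω +
        ∑' n : ℕ, (E.deviates a (fun z => z.1) k (n + 1)).indicator (fun _ => (1 : ENNReal)) ω +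
        ∑' n : ℕ, (E.deviates a (fun z => -z.2) k (n + 1)).indicator (fun _ => (1 : ENNReal)) ω +
        ∑' n : ℕ, (E.deviates a (fun z => -z.1) j (n + 1)).indicator (fun _ => (1 : ENNReal)) ω +
        ∑' n : ℕ, (E.deviates a (fun z => z.2) j (n + 1)).indicator
          (fun _ => (1 : ENNReal)) ω) ∂P := by
        refine lintegral_mono_ae ?_
        filter_upwards [E.ae_observed_mem a] with ω hω
        simp only [← ENNReal.tsum_add]
        refine ENNReal.tsum_le_tsum fun n => ?_
        by_cases hmem : ω ∈ E.alive a B n ∩ {ω | E.Initialized a (n + 1) ω} ∩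
          {ω | a (n + 1) ω = k}
        · rw [Set.indicator_of_mem hmem]
          by_cases h1 : ω ∈ E.deviates a (fun z => z.1) k (n + 1)
          · rw [Set.indicator_of_mem h1, add_assoc, add_assoc, add_assoc]
            exact le_self_add.trans le_add_self
          by_cases h2 : ω ∈ E.deviates a (fun z => -z.2) k (n + 1)
          · rw [Set.indicator_of_mem h2, add_assoc, add_assoc]
            exact le_self_add.trans le_add_self
          by_cases h3 : ω ∈ E.deviates a (fun z => -z.1) j (n + 1)
          · rw [Set.indicator_of_mem h3, add_assoc]
            exact le_self_add.trans le_add_self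
          by_cases h4 : ω ∈ E.deviates a (fun z => z.2) j (n + 1)
          · rw [Set.indicator_of_mem h4]
            exact le_add_self
          have hlt := ha.numPulls_lt hc0 hκ hj hk (fun t ht => (hω t ht).2) hmem.1.2 hmem.2
            h1 h2 h3 h4
          rw [Set.indicator_of_mem (s := E.alive a B n ∩ {ω | a (n + 1) ω = k ∧
            (numPulls a k (n + 1) ω : ℝ) < x * Real.log ((n : ℝ) + 1)}) ⟨hmem.1.1, hmem.2, hlt⟩]
          simp only [add_assoc]
          exact le_self_add
        · rw [Set.indicator_of_notMem hmem]
          exact zero_le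
    _ ≤ ENNReal.ofReal (x * Real.log ((B + 1) / ε) + 1) + ENNReal.ofReal Z + ENNReal.ofReal Z +
          ENNReal.ofReal Z + ENNReal.ofReal Z := by
        rw [lintegral_add_right _ (hna.measurable_tsum_deviates j measurable_snd),
          lintegral_add_right _ (hna.measurable_tsum_deviates j mn1),
          lintegral_add_right _ (hna.measurable_tsum_deviates k mn2),
          lintegral_add_right _ (hna.measurable_tsum_deviates k measurable_fst)]
        gcongr
    _ = _ := by
        rw [← ENNReal.ofReal_add (by positivity) hZ0, ← ENNReal.ofReal_add (by positivity) hZ0,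
          ← ENNReal.ofReal_add (by positivity) hZ0, ← ENNReal.ofReal_add (by positivity) hZ0]
        congr 1
        ring

theorem IsUCBSimplex.lintegral_gap_le {κ : ℝ} (ha : E.IsUCBSimplex (1 + κ) a) {B ε : ℝ}
    (hB : 0 ≤ B) (hε : 0 < ε) (hε1 : ε ≤ 1) (hc : ∀ k, ε ≤ E.meanCost k)
    (hκ : ∀ k, E.meanReward k / E.meanCost k ≤ κ) :
    ∫⁻ ω, ∑' n : ℕ, (E.alive a B n ∩ {ω | E.Initialized a (n + 1) ω}).indicator
        (fun ω => ENNReal.ofReal (E.gap (a (n + 1) ω) * E.meanCost (a (n + 1) ω))) ω ∂P ≤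
      ENNReal.ofReal (∑ k with 0 < E.gap k, (E.gap k * E.meanCost k) *
        (8 * (1 + κ) ^ 2 / (E.meanCost k * E.gap k) ^ 2 * Real.log ((B + 1) / ε) + 1 +
          4 * ∑' n : ℕ, 1 / ((n : ℝ) + 1) ^ 2)) := by
  have hna := ha.nonAnticipating
  have hc0 : ∀ k, 0 < E.meanCost k := fun k => hε.trans_le (hc k)
  have hlog : 0 ≤ Real.log ((B + 1) / ε) :=
    Real.log_nonneg (by rw [one_le_div hε]; linarith)
  have hZ0 : 0 ≤ ∑' n : ℕ, 1 / ((n : ℝ) + 1) ^ 2 := tsum_nonneg fun n => by positivity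
  have hmeas : ∀ k, Measurable fun ω =>
      ∑' n : ℕ, (E.alive a B n ∩ {ω | E.Initialized a (n + 1) ω} ∩
        {ω | a (n + 1) ω = k}).indicator (fun _ => (1 : ENNReal)) ω := fun k =>
    Measurable.tsum fun n => measurable_const.indicator
      (((E.history_le n _ (hna.measurableSet_alive B n)).inter
        (E.history_le n _ (hna.measurableSet_initialized n))).inter
        (E.history_le n _ (hna.measurable_arm n (measurableSet_singleton k))))
  -- Group the rounds by pulled arm; arms of zero gap contribute nothing.
  calc _ = ∫⁻ ω, ∑ k with 0 < E.gap k, ENNReal.ofReal (E.gap k * E.meanCost k) *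
        ∑' n : ℕ, (E.alive a B n ∩ {ω | E.Initialized a (n + 1) ω} ∩
          {ω | a (n + 1) ω = k}).indicator (fun _ => (1 : ENNReal)) ω ∂P := by
        refine lintegral_congr fun ω => ?_
        simp_rw [← ENNReal.tsum_mul_left]
        rw [← Summable.tsum_finsetSum fun _ _ => ENNReal.summable]
        refine tsum_congr fun n => ?_
        by_cases h : ω ∈ E.alive a B n ∩ {ω | E.Initialized a (n + 1) ω}
        · rw [Set.indicator_of_mem h, Finset.sum_filter, Finset.sum_eq_single (a (n + 1) ω)]
          · rw [Set.indicator_of_mem (s := E.alive a B n ∩ {ω | E.Initialized a (n + 1) ω} ∩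
              {ω' | a (n + 1) ω' = a (n + 1) ω}) ⟨h, rfl⟩, mul_one]
            split_ifs with hg
            · rfl
            · rw [le_antisymm (not_lt.1 hg) (E.gap_nonneg _)]; simp
          · intro b _ hb
            rw [Set.indicator_of_notMem fun hcon => hb hcon.2.symm]
            simp
          · simp
        · rw [Set.indicator_of_notMem h, Finset.sum_eq_zero]
          intro k _
          rw [Set.indicator_of_notMem fun hcon => h hcon.1, mul_zero]
    _ = ∑ k with 0 < E.gap k, ENNReal.ofReal (E.gap k * E.meanCost k) *
        ∫⁻ ω, ∑' n : ℕ, (E.alive a B n ∩ {ω | E.Initialized a (n + 1) ω} ∩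
          {ω | a (n + 1) ω = k}).indicator (fun _ => (1 : ENNReal)) ω ∂P := by
        rw [lintegral_finsetSum _ fun k _ => (hmeas k).const_mul _]
        exact Finset.sum_congr rfl fun k _ => lintegral_const_mul _ (hmeas k)
    _ ≤ ∑ k with 0 < E.gap k, ENNReal.ofReal (E.gap k * E.meanCost k) * ENNReal.ofReal
        (8 * (1 + κ) ^ 2 / (E.meanCost k * E.gap k) ^ 2 * Real.log ((B + 1) / ε) + 1 +
          4 * ∑' n : ℕ, 1 / ((n : ℝ) + 1) ^ 2) := by
        refine Finset.sum_le_sum fun k hk => ?_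
        gcongr
        exact ha.lintegral_pulls_le hB hε hε1 hc hκ (Finset.mem_filter.1 hk).2
    _ = _ := by
        rw [ENNReal.ofReal_sum_of_nonneg]
        · refine Finset.sum_congr rfl fun k hk => ?_
          rw [ENNReal.ofReal_mul (mul_nonneg (E.gap_nonneg k) (hc0 k).le)]
        · intro k _
          have := E.gap_nonneg k
          have := hc0 k
          positivity

theorem IsUCBSimplex.regretAfterInit_le {κ : ℝ} (ha : E.IsUCBSimplex (1 + κ) a) {B ε : ℝ}
    (hB : 0 ≤ B) (hε : 0 < ε) (hε1 : ε ≤ 1) (hc : ∀ k, ε ≤ E.meanCost k)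
    (hκ : ∀ k, E.meanReward k / E.meanCost k ≤ κ) (hK : 1 ≤ K) :
    E.regretAfterInit a B ≤ 8 * (1 + κ) ^ 2 *
      (∑ k with 0 < E.gap k, 1 / (E.meanCost k * E.gap k)) * Real.log ((B + 1) / ε) +
        K * regretConst κ := by
  have hc0 : ∀ k, 0 < E.meanCost k := fun k => hε.trans_le (hc k)
  have : Nonempty (Fin K) := ⟨⟨0, hK⟩⟩
  have hZ0 : 0 ≤ ∑' n : ℕ, 1 / ((n : ℝ) + 1) ^ 2 := tsum_nonneg fun n => by positivity
  have hlog : 0 ≤ Real.log ((B + 1) / ε) :=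
    Real.log_nonneg (by rw [one_le_div hε]; linarith)
  have hK' : (1 : ℝ) ≤ K := by exact_mod_cast hK
  set Z := ∑' n : ℕ, 1 / ((n : ℝ) + 1) ^ 2 with hZ
  have hρ0 := E.bestRatio_nonneg hc0
  have hρκ : (⨆ j, E.meanReward j / E.meanCost j) ≤ κ := ciSup_le hκ
  have hlow := ha.le_payoffAfterInit_add hB hε hc
  have hgap := ha.lintegral_gap_le hB hε hε1 hc hκ
  have hopt := E.optPayoff_le hc0 hB
  have hai : E.payoffAfterInit a B ≠ ⊤ :=
    ((E.payoffAfterInit_le_payoff a B).trans_lt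
      ((ha.nonAnticipating.payoff_le hc0 hB).trans_lt ENNReal.ofReal_lt_top)).ne
  set ρ := ⨆ j, E.meanReward j / E.meanCost j
  set S := ∑ k with 0 < E.gap k, (E.gap k * E.meanCost k) *
        (8 * (1 + κ) ^ 2 / (E.meanCost k * E.gap k) ^ 2 * Real.log ((B + 1) / ε) + 1 + 4 * Z) with hS
  have hS0 : 0 ≤ S := Finset.sum_nonneg fun k _ => by
    have := E.gap_nonneg k
    have := hc0 k
    positivity
  have hmain : ρ * B ≤ (E.payoffAfterInit a B).toReal + 1 + S + ρ * K := by
    rw [← ENNReal.ofReal_le_ofReal_iff (by positivity), ENNReal.ofReal_mul hρ0,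
      ENNReal.ofReal_add (by positivity) (by positivity),
      ENNReal.ofReal_add (by positivity) (by positivity),
      ENNReal.ofReal_add (by positivity) (by positivity), ENNReal.ofReal_toReal hai,
      ENNReal.ofReal_one, ENNReal.ofReal_mul hρ0, ENNReal.ofReal_natCast]
    exact hlow.trans (by gcongr)
  have hopt' : (E.optPayoff B).toReal ≤ ρ * (B + 1) :=
    ENNReal.toReal_le_of_le_ofReal (by positivity) hopt
  have hSle : S ≤ 8 * (1 + κ) ^ 2 *
      (∑ k with 0 < E.gap k, 1 / (E.meanCost k * E.gap k)) * Real.log ((B + 1) / ε) +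
        K * (κ * (1 + 4 * Z)) := by
    have hterm : ∀ k ∈ Finset.univ.filter (fun k => 0 < E.gap k), (E.gap k * E.meanCost k) *
        (8 * (1 + κ) ^ 2 / (E.meanCost k * E.gap k) ^ 2 * Real.log ((B + 1) / ε) + 1 + 4 * Z) ≤
        8 * (1 + κ) ^ 2 * Real.log ((B + 1) / ε) * (1 / (E.meanCost k * E.gap k)) +
          κ * (1 + 4 * Z) := by
      intro k hk
      have hg := (Finset.mem_filter.1 hk).2
      have hck := hc0 k
      -- Makes the additive part of the pull count cost at most `κ (1 + 4 Z)` per arm, uniformly in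
      -- the gaps.
      have h1 : E.gap k * E.meanCost k ≤ κ :=
        (mul_le_of_le_one_right hg.le (E.meanCost_le_one k)).trans (E.gap_le hc0 hκ k)
      have h2 : (E.gap k * E.meanCost k) *
        (8 * (1 + κ) ^ 2 / (E.meanCost k * E.gap k) ^ 2 * Real.log ((B + 1) / ε)) =
        8 * (1 + κ) ^ 2 * Real.log ((B + 1) / ε) * (1 / (E.meanCost k * E.gap k)) := by
        field_simp
      rw [add_assoc, mul_add, h2]
      gcongr
    refine (Finset.sum_le_sum hterm).trans ?_
    rw [Finset.sum_add_distrib, ← Finset.mul_sum, Finset.sum_const, nsmul_eq_mul]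
    have hcard : ((Finset.univ.filter (fun k => 0 < E.gap k)).card : ℝ) ≤ K := by
      have := Finset.card_filter_le (Finset.univ : Finset (Fin K)) (fun k => 0 < E.gap k)
      rw [Finset.card_univ, Fintype.card_fin] at this
      exact_mod_cast this
    have hκ0 : 0 ≤ κ := hρ0.trans hρκ
    have := mul_le_mul_of_nonneg_right hcard (show 0 ≤ κ * (1 + 4 * Z) by positivity)
    linarith
  have hρK : ρ * K ≤ κ * K := by gcongr
  have hκK : κ ≤ κ * K := le_mul_of_one_le_right (hρ0.trans hρκ) hK'
  -- Besides `S`, the loss is `ρ` (overshoot in the bound on the optimum), `1` (final round) and `ρ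
  -- K` (initialization); as `1 ≤ K`, this is at most `K (2 κ + 1)`.
  rw [regretAfterInit, regretConst, ← hZ]
  linarith

end Stopped

/-! ### Dependence on `B` and the main theorem -/

theorem log_div_le {B ε : ℝ} (hB : 2 ≤ B) (hε : 0 < ε) (hε1 : ε ≤ 1) :
    Real.log ((B + 1) / ε) ≤ (2 - Real.log ε / Real.log 2) * Real.log B := by
  have h2 : 0 < Real.log 2 := Real.log_pos one_lt_two
  have hlB : Real.log 2 ≤ Real.log B := Real.log_le_log two_pos hB
  have hlε : Real.log ε ≤ 0 := Real.log_nonpos hε.le hε1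
  -- For `2 ≤ B`, `B + 1 ≤ B ^ 2`.
  have h1 : Real.log (B + 1) ≤ 2 * Real.log B := by
    rw [← Real.log_rpow (by linarith)]
    refine Real.log_le_log (by linarith) ?_
    norm_num
    nlinarith
  have h3 : Real.log ε / Real.log 2 * Real.log B ≤ Real.log ε := by
    rw [div_mul_eq_mul_div, div_le_iff₀ h2]
    nlinarith
  rw [Real.log_div (by linarith) hε.ne', sub_mul]
  linarith

end Environment

end Knapsack

end

theorem mainTheorem3 :
    ∃ (C : ℕ → ℝ → ℝ → ℝ) (C' : ℝ → ℝ → ℝ),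
      ∀ (K : ℕ) (Ω : Type*) [MeasurableSpace Ω] (P : Measure Ω) [IsProbabilityMeasure P]
        (E : Knapsack.Environment K Ω P) (κ : ℝ) (a : ℕ → Ω → Fin K),
        (∀ k, 0 < E.meanCost k) →
        (∀ k, E.meanReward k / E.meanCost k ≤ κ) →
        E.IsUCBSimplex (1 + κ) a →
        (∀ B : ℝ, 0 ≤ B →
          E.optPayoff B ≠ ⊤ ∧
          0 ≤ E.regret a B ∧
          E.regret a B ≤ E.regretAfterInit a B ∧
          E.regretAfterInit a B ≤
            2 ^ 6 * (1 + κ) ^ 2 *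
                (∑ k with 0 < E.gap k, 1 / (E.meanCost k * E.gap k)) *
                Real.log ((B + 1) / E.minCost)
              + C K κ E.minCost) ∧
        ((∃ k, 0 < E.gap k) →
          ∀ B : ℝ, 2 ≤ B →
            E.regretAfterInit a B ≤ C' κ E.minCost * (K * Real.log B / E.minGap)) := by
  refine ⟨fun K κ _ => K * Knapsack.Environment.regretConst κ,
    fun κ ε => 8 * (1 + κ) ^ 2 / ε * (2 - Real.log ε / Real.log 2) +
      κ * Knapsack.Environment.regretConst κ / Real.log 2, ?_⟩
  intro K Ω _ P _ E κ a hc hκ ha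
  -- A probability space is nonempty and a run picks an arm at each of its points, so `1 ≤ K`.
  obtain ⟨ω⟩ : Nonempty Ω := P.nonempty_of_neZero
  have hne : Nonempty (Fin K) := ⟨a 0 ω⟩
  have hK : 1 ≤ K := Fin.pos (a 0 ω)
  have hε := E.minCost_pos hc
  have hle := E.minCost_le
  have hε1 : E.minCost ≤ 1 := (hle (a 0 ω)).trans (E.meanCost_le_one _)
  have hκ0 : 0 ≤ κ := (div_nonneg (E.meanReward_nonneg (a 0 ω)) (hc _).le).trans (hκ _)
  refine ⟨fun B hB => ?_, fun hgap B hB => ?_⟩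
  · have hopt : E.optPayoff B ≠ ⊤ := ((E.optPayoff_le hc hB).trans_lt ENNReal.ofReal_lt_top).ne
    have hp : E.payoff a B ≤ E.optPayoff B :=
      le_iSup₂_of_le (f := fun a (_ : E.NonAnticipating a) => E.payoff a B) a
        ha.nonAnticipating le_rfl
    have hpt : E.payoff a B ≠ ⊤ := ne_top_of_le_ne_top hopt hp
    refine ⟨hopt, sub_nonneg.2 (ENNReal.toReal_mono hopt hp),
      sub_le_sub_left (ENNReal.toReal_mono hpt (E.payoffAfterInit_le_payoff a B)) _, ?_⟩
    refine (ha.regretAfterInit_le hB hε hε1 hle hκ hK).trans ?_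
    have hlog : 0 ≤ Real.log ((B + 1) / E.minCost) :=
      Real.log_nonneg (by rw [one_le_div hε]; linarith)
    have hsum : 0 ≤ ∑ k with 0 < E.gap k, 1 / (E.meanCost k * E.gap k) :=
      Finset.sum_nonneg fun k _ => one_div_nonneg.2 (mul_nonneg (hc k).le (E.gap_nonneg k))
    gcongr
    norm_num
  · refine (ha.regretAfterInit_le (by linarith) hε hε1 hle hκ hK).trans ?_
    have hpos := E.minGap_pos hgap
    have hgκ : E.minGap ≤ κ := by
      obtain ⟨k, hk⟩ := hgap
      exact (E.minGap_le hk).trans (E.gap_le hc hκ k)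
    have h2 : 0 < Real.log 2 := Real.log_pos one_lt_two
    have hlB : Real.log 2 ≤ Real.log B := Real.log_le_log two_pos hB
    have hlog0 : 0 ≤ Real.log ((B + 1) / E.minCost) :=
      Real.log_nonneg (by rw [one_le_div hε]; linarith)
    have hr0 : 0 ≤ Knapsack.Environment.regretConst κ := by
      have : 0 ≤ ∑' n : ℕ, 1 / ((n : ℝ) + 1) ^ 2 := tsum_nonneg fun n => by positivity
      unfold Knapsack.Environment.regretConst
      positivity
    have hA : 8 * (1 + κ) ^ 2 * (∑ k with 0 < E.gap k, 1 / (E.meanCost k * E.gap k)) *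
        Real.log ((B + 1) / E.minCost) ≤ 8 * (1 + κ) ^ 2 * (K * (1 / (E.minCost * E.minGap))) *
          ((2 - Real.log E.minCost / Real.log 2) * Real.log B) := by
      gcongr
      · exact E.sum_one_div_le hε hle hgap
      · exact Knapsack.Environment.log_div_le hB hε hε1
    -- The additive constant is absorbed into the main term by factors at least 1: `κ / minGap` and
    -- `log B / log 2`.
    have hB' : K * Knapsack.Environment.regretConst κ ≤
        K * Knapsack.Environment.regretConst κ * (κ / E.minGap * (Real.log B / Real.log 2)) := by
      refine le_mul_of_one_le_right (by positivity) ?_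
      exact one_le_mul_of_one_le_of_one_le ((one_le_div hpos).2 hgκ) ((one_le_div h2).2 hlB)
    refine (add_le_add hA hB').trans_eq ?_
    field_simp
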